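/- **Setting.** Consider $\dot x=f(x)+g(x)u$ with $x\in\mathbb R^n$, $u\in\mathbb R^m$, $f,g$ locally Lipschitz, $f(0)=0$. Norms are Euclidean (operator norm for matrices), $L_fW=\nabla W^Tf$, $L_gW=\nabla W^Tg$. A $\mathcal K_\infty$ function is a strictly increasing $\alpha:\mathbb R\to\mathbb R$ with $\alpha(0)=0$, $\alpha(s)\to\infty$ as $s\to\infty$. Let $h\in C^1$, $\mathcal C=\{h\ge 0\}$, $\partial\mathcal C=\{h=0\}$, and let $h$ be an $\eta_h$-robust CBF ($\eta_h>0$) with $\alpha\in\mathcal K_\infty$: for all $x\in\mathcal C$ there is $u$ with $L_fh(x)+L_gh(x)u+\alpha(h(x))\ge\eta_h$. Let $V\in C^1$ be a CLF on a set $\Gamma\supseteq\mathcal C$ with $0\in\Gamma$: $V$ is positive definite, $\{x\in\Gamma: V(x)\le c\}$ is compact for all $c\ge0$, and there is a continuous positive definite $W$ such that for each $x\in\Gamma\setminus\{0\}$ some $u$ satisfies $L_fV(x)+L_gV(x)u\le -W(x)$. Let $S$ be positive definite, $\zeta\in\mathcal K_\infty$, $B:\mathbb R^n\to\mathbb R$,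 with $S$, $\alpha\circ h$, $\zeta\circ h$ continuous on $\mathcal C$, such that for every $x\in\mathcal C$ there is $u$ with $\|u\|\le B(x)$ and $$L_fV(x)+L_gV(x)u+W(x)\le -S(x),\qquad L_fh(x)+L_gh(x)u+\alpha(h(x))\ge\eta_h+\zeta(h(x)).$$ Let $\tilde{\mathcal C}$ be a neighborhood of $\mathcal C$, and $\hat f,\hat g,\hat h,\widehat{\nabla h}$ be estimates of $f,g,h,\nabla h$. A *trajectory* of $\dot x=F(x)$ on an interval is a continuous curve that satisfies the equation at all times at which it is not at the origin. A controller $k$ is *safe stabilizing* if, for $F=f+gk$, there is a trajectory on $[0,\infty)$ from every point of $\mathcal C$, every trajectory on a bounded interval $[0,T)$ starting in $\mathcal C$ extends to $[0,\infty)$, and all trajectories starting in $\mathcal C$ remain in $\mathcal C$, stay at the origin once there, and converge to the origin as $t\to\infty$. **(i) Worst-case bounds.** Suppose that on $\mathcal C$ one has $\|f-\hat f\|\le e_f$, $\|g-\hat g\|\le e_g$, $|h-\hat h|\le e_h$, $\|\nabla h-\widehat{\nabla h}\|\le e_{\nabla h}$, that $\alpha$ is $K_\alpha$-Lipschitz,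 and that for all $x\in\tilde{\mathcal C}\setminus\{0\}$ (argument $x$ omitted) $$\|\nabla V\|(e_f+e_gB)<\tfrac12S,\qquad (e_{\nabla h}+\|\widehat{\nabla h}\|)(e_f+e_gB)+K_\alpha e_h+e_{\nabla h}(\|\hat f\|+\|\hat g\|B)<\tfrac12(\eta_h+\zeta(h)).$$ Then there is a safe stabilizing controller $k$, $C^\infty$ on $\tilde{\mathcal C}\setminus\{0\}$, with $k(0)=0$. If moreover the coefficients $a_V,b_V,c_V,a_h,b_h,c_h$ below are continuous on $\mathcal C\setminus\{0\}$, the same $k$ can be chosen to satisfy there $a_V\|k\|\le b_Vk+c_V$ and $a_h\|k\|\le b_hk+c_h$, where $a_V=\|\nabla V\|e_g$, $b_V=-\nabla V^T\hat g$, $c_V=-\|\nabla V\|e_f-\nabla V^T\hat f-W$, $a_h=e_{\nabla h}e_g+e_{\nabla h}\|\hat g\|+\|\widehat{\nabla h}\|e_g$, $b_h=\widehat{\nabla h}^T\hat g$, $c_h=-e_{\nabla h}e_f-e_{\nabla h}\|\hat f\|-\|\widehat{\nabla h}\|e_f+\widehat{\nabla h}^T\hat f+\alpha(\hat h-e_h)$.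 **(ii) Gaussian processes.** Let $$\Delta_V(x,u)=L_fV+L_gVu-\nabla V^T\hat f-\nabla V^T\hat gu,\qquad \Delta_h(x,u)=L_fh+L_gh\,u+\alpha(h)-\widehat{\nabla h}^T\hat f-\widehat{\nabla h}^T\hat gu-\alpha(\hat h).$$ For each $\Delta\in\{\Delta_V,\Delta_h\}$ let Gaussian process regression be given as follows, both on one probability space: a reproducing kernel Hilbert space $H$ of functions of $(x,u)$ with kernel $K$; a sampling domain $D$ and points $z_1,\dots,z_N\in D$; an element of $H$ of norm at most $b$ that agrees with $\Delta$ on $(\mathcal C\times\mathbb R^m)\cup D$; measurements $y_i=\Delta(z_i)+\varepsilon_i$ with independent centred noise, $|\varepsilon_i|\le\sigma$ almost surely, $\sigma>0$. With $K_p=(K(p_i,p_j))_{i,j}$ and $\kappa(z)=(K(z_i,z))_i$, the predicted mean is $\mu(z)=\kappa(z)^T(K_{(z_i)}+\sigma^2I)^{-1}y$ and the variance $s^2(z)=K(z,z)-\kappa(z)^T(K_{(z_i)}+\sigma^2I)^{-1}\kappa(z)$. Assume that the maximum information gain $I_{N+1}=\sup_{p\in D^{N+1}}\frac12\log\det(I+\sigma^{-2}K_p)$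 is finite, and that for $x\in\mathcal C$, $u\in\mathbb R^m$ and all data $y$, $\mu(x,u)=\gamma(x)^T\begin{bmatrix}1\\u\end{bmatrix}$ and $s(x,u)=\left\|G(x)\begin{bmatrix}1\\u\end{bmatrix}\right\|$ (with $\gamma=\gamma_V,\gamma_h$, depending on the data, and $G=G_V,G_h$). Let $\delta\in(0,1)$ and let $\beta$ be at least $\sqrt{2b^2+300\,I_{N+1}\log^3((N+1)/\delta)}$ for both regressions. Suppose that for all $x\in\tilde{\mathcal C}\setminus\{0\}$ $$\sigma_{\max}(G_V(x))<\frac{S(x)}{2\beta\sqrt{1+B(x)^2}},\qquad \sigma_{\max}(G_h(x))<\frac{\eta_h+\zeta(h(x))}{2\beta\sqrt{1+B(x)^2}}.$$ Then there is a controller $k$, computed from the measured data, with $k(0)=0$ and $C^\infty$ on $\tilde{\mathcal C}\setminus\{0\}$ for all data, such that with probability at least $1-2\delta$: $k$ is safe stabilizing and, if the vectors and matrices $Q_V,r_V,b_V,c_V,Q_h,r_h,b_h,c_h$ below are continuous on $\mathcal C\setminus\{0\}$, $k$ satisfies there $\|Q_Vk+r_V\|\le b_Vk+c_V$ and $\|Q_hk+r_h\|\le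 b_hk+c_h$. Here $Q_V,Q_h$ are $\beta$ times columns $2,\dots,m+1$ of $G_V,G_h$ and $r_V,r_h$ are $\beta$ times their first columns; $b_V=-\nabla V^T\hat g-\gamma_{V,2:m+1}^T$, $c_V=-\nabla V^T\hat f-W-\gamma_{V,1}$, $b_h=\widehat{\nabla h}^T\hat g+\gamma_{h,2:m+1}^T$, $c_h=\widehat{\nabla h}^T\hat f+\gamma_{h,1}+\alpha(\hat h)$. -/

import Mathlib

open Set Filter Topology MeasureTheory
open scoped Gradient InnerProductSpace Matrix

noncomputable section

namespace SafeStab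

/-! ### Control-affine systems, control Lyapunov and control barrier functions -/

/-- `ℝⁿ` with the Euclidean norm. -/
abbrev Vec (n : ℕ) : Type := EuclideanSpace ℝ (Fin n)

/-- The pair `(f, g)` of a control-affine system `ẋ = f(x) + g(x) u`. The norm of `g x` is the
operator norm induced by the Euclidean norms. -/
structure ControlSystem (n m : ℕ) where
  f : Vec n → Vec n
  g : Vec n → Vec m →L[ℝ] Vec n

/-- The closed-loop vector field `x ↦ f(x) + g(x) k(x)`. -/
def ControlSystem.closedLoop {n m : ℕ} (sys : ControlSystem n m) (k : Vec n → Vec m) :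
    Vec n → Vec n :=
  fun x => sys.f x + sys.g x (k x)

/-- `L_f W(x) + L_g W(x) u`. -/
def lieDeriv {n m : ℕ} (sys : ControlSystem n m) (W : Vec n → ℝ) (x : Vec n) (u : Vec m) : ℝ :=
  ⟪∇ W x, sys.f x⟫_ℝ + ⟪∇ W x, sys.g x u⟫_ℝ

/-- Class `𝒦∞` functions on `ℝ`. -/
structure IsClassKInf (α : ℝ → ℝ) : Prop where
  zero : α 0 = 0
  strictMono : StrictMono α
  tendsto : Tendsto α atTop atTop

/-- Positive definite functions. -/
def IsPosDefFun {n : ℕ} (V : Vec n → ℝ) : Prop :=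
  V 0 = 0 ∧ ∀ x, x ≠ 0 → 0 < V x

/-- `V` is a control Lyapunov function on `Γ`, with decay function `W`. -/
structure IsCLF {n m : ℕ} (sys : ControlSystem n m) (Γ : Set (Vec n)) (V W : Vec n → ℝ) :
    Prop where
  zero_mem : (0 : Vec n) ∈ Γ
  contDiff : ContDiff ℝ 1 V
  proper : ∀ c : ℝ, 0 ≤ c → IsCompact {x | x ∈ Γ ∧ V x ≤ c}
  posDef : IsPosDefFun V
  decay_continuous : Continuous W
  decay_posDef : IsPosDefFun W
  decrease : ∀ x ∈ Γ \ {0}, ∃ u : Vec m, lieDeriv sys V x u ≤ -W x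

/-- `h` is an `η`-robust control barrier function of `C`, with class `𝒦∞` function `α`. -/
structure IsRobustCBF {n m : ℕ} (sys : ControlSystem n m) (C : Set (Vec n)) (h : Vec n → ℝ)
    (η : ℝ) (α : ℝ → ℝ) : Prop where
  eta_pos : 0 < η
  contDiff : ContDiff ℝ 1 h
  set_eq : C = {x | 0 ≤ h x}
  frontier_eq : frontier C = {x | h x = 0}
  classKInf : IsClassKInf α
  barrier : ∀ x ∈ C, ∃ u : Vec m, η ≤ lieDeriv sys h x u + α (h x)

/-- At every point of `C` some control of norm at most `B x` satisfies both the CLF inequality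
with slack `S` and the robust CBF inequality with slack `ζ ∘ h`. -/
def SlackCompatible {n m : ℕ} (sys : ControlSystem n m) (C : Set (Vec n))
    (V W S h : Vec n → ℝ) (η : ℝ) (α ζ : ℝ → ℝ) (B : Vec n → ℝ) : Prop :=
  ∀ x ∈ C, ∃ u : Vec m,
    lieDeriv sys V x u + W x ≤ -S x ∧
    η + ζ (h x) ≤ lieDeriv sys h x u + α (h x) ∧
    ‖u‖ ≤ B x

/-! ### Trajectories -/

/-- `x` is a trajectory of `ẋ = F(x)` on the time interval `I`, for a vector field `F` that is
only regular away from the origin: `x` is continuous, and the differential equation holds at all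
times at which `x` is not at the origin. Every classical solution is such a trajectory; the ones
that are not classical are those that arrive at the origin in finite time. -/
structure IsTrajectoryOn {n : ℕ} (F : Vec n → Vec n) (I : Set ℝ) (x : ℝ → Vec n) : Prop where
  continuousOn : ContinuousOn x I
  hasDeriv : ∀ t ∈ I, x t ≠ 0 → HasDerivWithinAt x (F (x t)) I t

/-- Trajectories of `ẋ = F(x)` that start in `C` exist for all nonnegative times, remain in `C`
and converge to the origin (where they stay if they reach it). -/
structure IsSafeStabilized {n : ℕ} (F : Vec n → Vec n) (C : Set (Vec n)) : Prop where
  /-- through every point of `C` there is a trajectory defined for all times -/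
  exists_trajectory : ∀ x₀ ∈ C, ∃ x, IsTrajectoryOn F (Ici 0) x ∧ x 0 = x₀
  /-- trajectories, even those defined on a bounded time interval only, do not leave `C` -/
  invariant : ∀ T x, 0 < T → IsTrajectoryOn F (Ico 0 T) x → x 0 ∈ C → ∀ t ∈ Ico 0 T, x t ∈ C
  /-- trajectories do not leave the origin -/
  absorbing : ∀ T x, 0 < T → IsTrajectoryOn F (Ico 0 T) x → x 0 ∈ C →
    ∀ s ∈ Ico 0 T, ∀ t ∈ Ico 0 T, s ≤ t → x s = 0 → x t = 0
  /-- a trajectory on a bounded time interval can be continued for all times -/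
  extends_global : ∀ T x, 0 < T → IsTrajectoryOn F (Ico 0 T) x → x 0 ∈ C →
    ∃ y, IsTrajectoryOn F (Ici 0) y ∧ EqOn x y (Ico 0 T)
  /-- trajectories converge to the origin -/
  tendsto_zero : ∀ x, IsTrajectoryOn F (Ici 0) x → x 0 ∈ C → Tendsto x atTop (𝓝 0)

/-! ### Estimates and worst-case errors -/

/-- Estimates `f̂`, `ĝ` (a nominal system), `ĥ` and `∇̂h`. -/
structure Estimates (n m : ℕ) extends ControlSystem n m where
  h : Vec n → ℝ
  dh : Vec n → Vec n

/-- Bounds `e_f`, `e_g`, `e_h`, `e_∇h` on the estimation errors. -/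
structure ErrorBounds (n : ℕ) where
  ef : Vec n → ℝ
  eg : Vec n → ℝ
  eh : Vec n → ℝ
  edh : Vec n → ℝ

/-- The errors of the estimates are within the bounds on `C`. -/
structure ErrorBounds.Valid {n m : ℕ} (e : ErrorBounds n) (sys : ControlSystem n m)
    (h : Vec n → ℝ) (est : Estimates n m) (C : Set (Vec n)) : Prop where
  f_le : ∀ x ∈ C, ‖sys.f x - est.f x‖ ≤ e.ef x
  g_le : ∀ x ∈ C, ‖sys.g x - est.g x‖ ≤ e.eg x
  h_le : ∀ x ∈ C, |h x - est.h x| ≤ e.eh x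
  dh_le : ∀ x ∈ C, ‖∇ h x - est.dh x‖ ≤ e.edh x

/-- A state-dependent second-order cone constraint `‖Q(x) u + r(x)‖ ≤ b(x)ᵀ u + c(x)`. -/
structure SOCC (n m : ℕ) where
  Q : Vec n → Matrix (Fin (m + 1)) (Fin m) ℝ
  r : Vec n → Vec (m + 1)
  b : Vec n → Vec m
  c : Vec n → ℝ

/-- The control `u` satisfies the constraint at `x`. -/
def SOCC.Holds {n m : ℕ} (q : SOCC n m) (x : Vec n) (u : Vec m) : Prop :=
  ‖Matrix.toEuclideanLin (q.Q x) u + q.r x‖ ≤ ⟪q.b x, u⟫_ℝ + q.c x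

/-- The data of the constraint are continuous on `s`. -/
structure SOCC.ContOn {n m : ℕ} (q : SOCC n m) (s : Set (Vec n)) : Prop where
  Q_cont : ContinuousOn q.Q s
  r_cont : ContinuousOn q.r s
  b_cont : ContinuousOn q.b s
  c_cont : ContinuousOn q.c s

/-- The constraint `a(x) ‖u‖ ≤ b(x)ᵀ u + c(x)` (for `a ≥ 0`), with `Q` the identity matrix times
`a(x)`, extended by a zero row, and `r = 0`. -/
def SOCC.ofNorm {n m : ℕ} (a : Vec n → ℝ) (b : Vec n → Vec m) (c : Vec n → ℝ) : SOCC n m where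
  Q x := a x • Matrix.of fun i j => if i = Fin.castSucc j then 1 else 0
  r _ := 0
  b := b
  c := c

/-- Robust stability constraint under worst-case errors. -/
def worstCaseSOCCV {n m : ℕ} (est : Estimates n m) (e : ErrorBounds n) (V W : Vec n → ℝ) :
    SOCC n m :=
  SOCC.ofNorm
    (fun x => ‖∇ V x‖ * e.eg x)
    (fun x => -(ContinuousLinearMap.adjoint (est.g x) (∇ V x)))
    (fun x => -(‖∇ V x‖ * e.ef x) - ⟪∇ V x, est.f x⟫_ℝ - W x)

/-- Robust safety constraint under worst-case errors. -/
def worstCaseSOCCh {n m : ℕ} (est : Estimates n m) (e : ErrorBounds n) (α : ℝ → ℝ) :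
    SOCC n m :=
  SOCC.ofNorm
    (fun x => e.edh x * e.eg x + e.edh x * ‖est.g x‖ + ‖est.dh x‖ * e.eg x)
    (fun x => ContinuousLinearMap.adjoint (est.g x) (est.dh x))
    (fun x => -(e.edh x * e.ef x) - e.edh x * ‖est.f x‖ - ‖est.dh x‖ * e.ef x
      + ⟪est.dh x, est.f x⟫_ℝ + α (est.h x - e.eh x))

/-- The worst-case errors are small compared with the slacks, on `s`. -/
def SmallErrors {n m : ℕ} (est : Estimates n m) (e : ErrorBounds n) (V S h B : Vec n → ℝ)
    (η : ℝ) (ζ : ℝ → ℝ) (Kα : ℝ) (s : Set (Vec n)) : Prop :=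
  ∀ x ∈ s,
    ‖∇ V x‖ * (e.ef x + e.eg x * B x) < 1 / 2 * S x ∧
    (e.edh x + ‖est.dh x‖) * (e.ef x + e.eg x * B x) + Kα * e.eh x
      + e.edh x * (‖est.f x‖ + ‖est.g x‖ * B x) < 1 / 2 * (η + ζ (h x))

/-! ### Gaussian process predictions -/

section GP

variable {Z : Type*} (H : Type*) [NormedAddCommGroup H] [InnerProductSpace ℝ H] [CompleteSpace H]
  [RKHS ℝ H Z ℝ]

/-- The scalar kernel `K(z, z')` of a reproducing kernel Hilbert space of real functions. -/
def kern (z z' : Z) : ℝ := RKHS.kernel H z z' 1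

/-- The Gram matrix of the kernel at finitely many points. -/
def gram {N : ℕ} (p : Fin N → Z) : Matrix (Fin N) (Fin N) ℝ :=
  Matrix.of fun i j => kern H (p i) (p j)

/-- Information gain `½ log det (I + σ⁻² K_p)` of noisy evaluations at the points `p`. -/
def infoGain (σ : ℝ) {N : ℕ} (p : Fin N → Z) : ℝ :=
  1 / 2 * Real.log (1 + (σ ^ 2)⁻¹ • gram H p).det

/-- The possible information gains from `N` samples in `D`. -/
def infoGains (σ : ℝ) (D : Set Z) (N : ℕ) : Set ℝ :=
  {γ | ∃ p : Fin N → Z, (∀ i, p i ∈ D) ∧ γ = infoGain H σ p}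

variable {Ω : Type*} [MeasurableSpace Ω]

/-- Gaussian process regression, with prior `𝒢𝒫(0, K)` for `K` the kernel of `H`, of an unknown
function `Δ` from `N` noisy measurements `Δ(zᵢ) + εᵢ` at points of a sampling domain `D`. On `D`
and on the set `A` where the prediction is used, `Δ` agrees with an element of `H` of norm at most
`bound`; the noise is independent, centred and bounded by `σ`. -/
structure GPRegression (P : Measure Ω) (A : Set Z) (Δ : Z → ℝ) where
  N : ℕ
  pt : Fin N → Z
  D : Set Z
  pt_mem : ∀ i, pt i ∈ D
  σ : ℝ
  σ_pos : 0 < σ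
  bddAbove_gain : BddAbove (infoGains H σ D (N + 1))
  noise : Fin N → Ω → ℝ
  noise_measurable : ∀ i, Measurable (noise i)
  noise_indep : ProbabilityTheory.iIndepFun noise P
  noise_mean : ∀ i, ∫ ω, noise i ω ∂P = 0
  noise_bound : ∀ i, ∀ᵐ ω ∂P, |noise i ω| ≤ σ
  bound : ℝ
  target : H
  target_norm : ‖target‖ ≤ bound
  target_eq : ∀ z ∈ A ∪ D, target z = Δ z

namespace GPRegression

variable {H} {P : Measure Ω} {A : Set Z} {Δ : Z → ℝ} (M : GPRegression H P A Δ)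

/-- The measurements. -/
def obs (ω : Ω) : Fin M.N → ℝ := fun i => Δ (M.pt i) + M.noise i ω

/-- `(K_p + σ² I)⁻¹` -/
def regInv : Matrix (Fin M.N) (Fin M.N) ℝ :=
  (gram H M.pt + M.σ ^ 2 • (1 : Matrix (Fin M.N) (Fin M.N) ℝ))⁻¹

/-- The vector of the `K(zᵢ, z)`. -/
def kvec (z : Z) : Fin M.N → ℝ := fun i => kern H (M.pt i) z

/-- Posterior mean at `z`, given measured values `y`. -/
def mean (y : Fin M.N → ℝ) (z : Z) : ℝ := M.kvec z ⬝ᵥ M.regInv *ᵥ y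

/-- Posterior variance at `z`. -/
def var (z : Z) : ℝ := kern H z z - M.kvec z ⬝ᵥ M.regInv *ᵥ M.kvec z

/-- Posterior standard deviation at `z`. -/
def std (z : Z) : ℝ := √(M.var z)

/-- The confidence constant: the square root of
`2 bound² + 300 γ_{N+1} log³((N+1)/δ)`, with `γ_{N+1}` the maximum information gain. -/
def beta (δ : ℝ) : ℝ :=
  √(2 * M.bound ^ 2 +
    300 * sSup (infoGains H M.σ M.D (M.N + 1)) * Real.log ((M.N + 1 : ℝ) / δ) ^ 3)

end GPRegression

end GP

/-- `Δ_V(x, u)`, the error of the nominal model in the derivative of `V`. -/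
def deltaV {n m : ℕ} (sys : ControlSystem n m) (est : Estimates n m) (V : Vec n → ℝ)
    (z : Vec n × Vec m) : ℝ :=
  lieDeriv sys V z.1 z.2 - ⟪∇ V z.1, est.f z.1⟫_ℝ - ⟪∇ V z.1, est.g z.1 z.2⟫_ℝ

/-- `Δ_h(x, u)`, the error of the nominal model in the barrier inequality. -/
def deltaH {n m : ℕ} (sys : ControlSystem n m) (est : Estimates n m) (h : Vec n → ℝ)
    (α : ℝ → ℝ) (z : Vec n × Vec m) : ℝ :=
  lieDeriv sys h z.1 z.2 + α (h z.1)
    - ⟪est.dh z.1, est.f z.1⟫_ℝ - ⟪est.dh z.1, est.g z.1 z.2⟫_ℝ - α (est.h z.1)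

/-- The vector `[1; u]`. -/
def augment {m : ℕ} (u : Vec m) : Vec (m + 1) :=
  WithLp.toLp 2 (Fin.cons (1 : ℝ) (fun j => u j) : Fin (m + 1) → ℝ)

/-- The entries `2, …, m+1` of a vector. -/
def tail {m : ℕ} (γ : Vec (m + 1)) : Vec m := WithLp.toLp 2 fun j => γ j.succ

/-- The maximum singular value of a matrix. -/
def sigmaMax {p q : ℕ} (G : Matrix (Fin p) (Fin q) ℝ) : ℝ :=
  (Matrix.toEuclideanLin G).singularValues 0

/-- On `C`, the mean and standard deviation of the prediction are `γ(x)ᵀ [1; u]` and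
`‖G(x) [1; u]‖`. -/
structure GPRegression.IsAffineQuadratic {n m : ℕ} {H : Type*} [NormedAddCommGroup H]
    [InnerProductSpace ℝ H] [CompleteSpace H] [RKHS ℝ H (Vec n × Vec m) ℝ]
    {Ω : Type*} [MeasurableSpace Ω] {P : Measure Ω} {A : Set (Vec n × Vec m)}
    {Δ : Vec n × Vec m → ℝ} (M : GPRegression H P A Δ) (C : Set (Vec n))
    (γ : (Fin M.N → ℝ) → Vec n → Vec (m + 1))
    (G : Vec n → Matrix (Fin (m + 1)) (Fin (m + 1)) ℝ) : Prop where
  mean_eq : ∀ y, ∀ x ∈ C, ∀ u : Vec m, M.mean y (x, u) = ⟪γ y x, augment u⟫_ℝ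
  std_eq : ∀ x ∈ C, ∀ u : Vec m, M.std (x, u) = ‖Matrix.toEuclideanLin (G x) (augment u)‖

/-- Probabilistic stability constraint. -/
def gpSOCCV {n m : ℕ} (est : Estimates n m) (V W : Vec n → ℝ) (β : ℝ)
    (γ : Vec n → Vec (m + 1)) (G : Vec n → Matrix (Fin (m + 1)) (Fin (m + 1)) ℝ) :
    SOCC n m where
  Q x := β • (G x).submatrix id Fin.succ
  r x := β • WithLp.toLp 2 fun i => G x i 0
  b x := -(ContinuousLinearMap.adjoint (est.g x) (∇ V x)) - tail (γ x)
  c x := -⟪∇ V x, est.f x⟫_ℝ - W x - γ x 0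

/-- Probabilistic safety constraint. -/
def gpSOCCh {n m : ℕ} (est : Estimates n m) (α : ℝ → ℝ) (β : ℝ)
    (γ : Vec n → Vec (m + 1)) (G : Vec n → Matrix (Fin (m + 1)) (Fin (m + 1)) ℝ) :
    SOCC n m where
  Q x := β • (G x).submatrix id Fin.succ
  r x := β • WithLp.toLp 2 fun i => G x i 0
  b x := ContinuousLinearMap.adjoint (est.g x) (est.dh x) + tail (γ x)
  c x := ⟪est.dh x, est.f x⟫_ℝ + γ x 0 + α (est.h x)

/-- The variances of the predictions are small compared with the slacks, on `s`. -/
def SmallVariances {n m : ℕ} (GV Gh : Vec n → Matrix (Fin (m + 1)) (Fin (m + 1)) ℝ)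
    (S h B : Vec n → ℝ) (η : ℝ) (ζ : ℝ → ℝ) (β : ℝ) (s : Set (Vec n)) : Prop :=
  ∀ x ∈ s,
    sigmaMax (GV x) < S x / (2 * β * √(1 + B x ^ 2)) ∧
    sigmaMax (Gh x) < (η + ζ (h x)) / (2 * β * √(1 + B x ^ 2))

end SafeStab

end

open SafeStab

/-! At a nonzero point of `C` the controls given by `SlackCompatible` satisfy the Lyapunov and
barrier inequalities with room to spare. Strict inequalities survive a small change of the state
with the control held fixed, and the admissible controls form convex sets. A smooth partition of
unity off the origin therefore glues locally constant controls into a smooth controller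
(`exists_smooth_selection`, `exists_safe_stabilizing_controller`). It is set to `0` at the origin,
where it need not be continuous. If the origin lies on the boundary of `C`, growth of `h` is imposed
on a whole ball around it, because continuity cannot supply it there.

The closed loop then carries a `ClosedLoopCertificate`. The sign of the derivative of `h` just
outside `C` gives invariance. Monotonicity of `V`, compact sublevel sets and local Lipschitz
continuity off the origin give continuation, and the decay rate `W` gives convergence. A trajectory
that arrives at the origin is continued by the constant zero curve.

The cone constraints enter as further convex requirements on the control. Each includes a margin for
the estimation error, and passing from the true inequality to the estimated one costs the same
margin again. Errors below half the slack thus make the compatible controls satisfy the constraints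
strictly. Those controls are known to satisfy the true inequalities, so the estimates matter only
for this extra requirement.

For Gaussian processes the margin is `β` times the standard deviation, and `exists_confidence_event`
must justify it. The error of the mean is the target paired with the residual of a ridge regression,
minus a linear form in the noise. Both are at most a constant times the posterior standard deviation
(`posterior_noise_sq_le`). The noise constant is a quadratic form of `K (K + s)⁻¹`. Hoeffding's
inequality along each eigenvector of the Gram matrix, a union bound, and `1 - 1/r ≤ log r` bound it
by a log determinant, that is, by the information gain. The resulting event does not depend on the
state or the control. -/

namespace SafeStab

/-! ### Comparison principle and trajectories. -/

/-- A continuous function that is nonincreasing whenever it exceeds `c`, and starts at or below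
`c`, does not exceed `c`. -/
lemma le_of_hasDerivAt_nonpos_of_gt {φ φ' : ℝ → ℝ} {a b c : ℝ} (hab : a ≤ b)
    (hφ : ContinuousOn φ (Icc a b)) (ha : φ a ≤ c)
    (hd : ∀ t ∈ Ioo a b, c < φ t → HasDerivAt φ (φ' t) t ∧ φ' t ≤ 0) : φ b ≤ c := by
  by_contra! hb
  set A : Set ℝ := Icc a b ∩ φ ⁻¹' Iic c with hA
  have hAc : IsCompact A :=
    isCompact_Icc.of_isClosed_subset (hφ.preimage_isClosed_of_isClosed isClosed_Icc isClosed_Iic)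
      inter_subset_left
  have hne : A.Nonempty := ⟨a, ⟨le_rfl, hab⟩, ha⟩
  -- `s` is the last time with `φ ≤ c`; beyond it `φ` exceeds `c`, hence is antitone on `[s, b]`.
  obtain ⟨hs, hsc⟩ := hAc.sSup_mem hne
  set s := sSup A
  have hlt : ∀ t ∈ Ioc s b, c < φ t := by
    intro t ht
    by_contra! hle
    exact absurd (le_csSup hAc.bddAbove ⟨⟨hs.1.trans ht.1.le, ht.2⟩, hle⟩) (not_le.2 ht.1)
  have hsub : Icc s b ⊆ Icc a b := Icc_subset_Icc_left hs.1
  have hD : ∀ t ∈ interior (Icc s b), HasDerivAt φ (φ' t) t ∧ φ' t ≤ 0 := by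
    intro t ht
    rw [interior_Icc] at ht
    exact hd t ⟨hs.1.trans_lt ht.1, ht.2⟩ (hlt t ⟨ht.1, ht.2.le⟩)
  have hanti : AntitoneOn φ (Icc s b) :=
    antitoneOn_of_hasDerivWithinAt_nonpos (convex_Icc s b) (hφ.mono hsub)
      (fun t ht => (hD t ht).1.hasDerivWithinAt) (fun t ht => (hD t ht).2)
  have := hanti (left_mem_Icc.2 hs.2) (right_mem_Icc.2 hs.2) hs.2
  exact absurd (this.trans hsc) (not_le.2 hb)

/-- A vector field with a barrier function `h` and a Lyapunov function `V` on `C`. -/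
structure ClosedLoopCertificate {n : ℕ} (F : Vec n → Vec n) (C : Set (Vec n))
    (V W h : Vec n → ℝ) : Prop where
  V_contDiff : ContDiff ℝ 1 V
  h_contDiff : ContDiff ℝ 1 h
  set_eq : C = {x | 0 ≤ h x}
  zero_mem : (0 : Vec n) ∈ C
  proper : ∀ c : ℝ, IsCompact {x | x ∈ C ∧ V x ≤ c}
  V_posDef : IsPosDefFun V
  W_continuous : Continuous W
  W_posDef : IsPosDefFun W
  decrease : ∀ x ∈ C \ {0}, ⟪∇ V x, F x⟫_ℝ ≤ -W x
  -- Only states outside `C` are constrained. As the origin lies in `C`, the value of `F` there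
  -- plays no role.
  barrier : ∀ x ∈ C, ∀ᶠ y in 𝓝 x, h y < 0 → 0 < ⟪∇ h y, F y⟫_ℝ
  lipschitz : ∀ x, x ≠ 0 → ∃ K, ∃ s ∈ 𝓝 x, LipschitzOnWith K F s

lemma hasDerivWithinAt_comp_gradient {n : ℕ} {f : Vec n → ℝ} (hf : ContDiff ℝ 1 f)
    {x : ℝ → Vec n} {v : Vec n} {s : Set ℝ} {t : ℝ} (hx : HasDerivWithinAt x v s t) :
    HasDerivWithinAt (fun t => f (x t)) ⟪∇ f (x t), v⟫_ℝ s t := by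
  have h1 : HasGradientAt f (∇ f (x t)) (x t) :=
    (hf.differentiable one_ne_zero (x t)).hasGradientAt
  have h2 := h1.hasFDerivAt.comp_hasDerivWithinAt t hx
  simpa [Function.comp_def] using h2

lemma continuous_gradient {n : ℕ} {f : Vec n → ℝ} (hf : ContDiff ℝ 1 f) :
    Continuous (fun x => ∇ f x) :=
  (InnerProductSpace.toDual ℝ (Vec n)).symm.continuous.comp (hf.continuous_fderiv one_ne_zero)

lemma IsTrajectoryOn.mono {n : ℕ} {F : Vec n → Vec n} {I J : Set ℝ} {x : ℝ → Vec n}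
    (hx : IsTrajectoryOn F I x) (hJ : J ⊆ I) : IsTrajectoryOn F J x :=
  ⟨hx.continuousOn.mono hJ, fun t ht h0 => (hx.hasDeriv t (hJ ht) h0).mono hJ⟩

/-- Being a trajectory is a local property. -/
lemma IsTrajectoryOn.of_local {n : ℕ} {F : Vec n → Vec n} {I : Set ℝ} {x : ℝ → Vec n}
    (h : ∀ t ∈ I, ∃ J ∈ 𝓝[I] t, ∃ y, t ∈ J ∧ IsTrajectoryOn F J y ∧ EqOn x y J) :
    IsTrajectoryOn F I x := by
  constructor
  · intro t ht
    obtain ⟨J, hJ, y, htJ, hy, hxy⟩ := h t ht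
    exact ((hy.continuousOn t htJ).congr hxy (hxy htJ)).mono_of_mem_nhdsWithin hJ
  · intro t ht h0
    obtain ⟨J, hJ, y, htJ, hy, hxy⟩ := h t ht
    have h1 := hy.hasDeriv t htJ (by rwa [← hxy htJ])
    rw [← hxy htJ] at h1
    exact (h1.congr hxy (hxy htJ)).mono_of_mem_nhdsWithin hJ

/-- No equation is imposed at the origin, so `F 0` is arbitrary. This curve continues the
trajectories that arrive at the origin. -/
lemma isTrajectoryOn_zero {n : ℕ} (F : Vec n → Vec n) (I : Set ℝ) :
    IsTrajectoryOn F I (fun _ => 0) :=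
  ⟨continuousOn_const, fun _ _ h => absurd rfl h⟩

lemma IsTrajectoryOn.hasDerivAt {n : ℕ} {F : Vec n → Vec n} {T : ℝ} {x : ℝ → Vec n}
    (hx : IsTrajectoryOn F (Ico 0 T) x) {t : ℝ} (h0 : 0 < t) (hT : t < T) (hne : x t ≠ 0) :
    HasDerivAt x (F (x t)) t :=
  (hx.hasDeriv t ⟨h0.le, hT⟩ hne).hasDerivAt (Ico_mem_nhds h0 hT)

/-- Concatenation of a trajectory on `[0, T)` with one starting at its endpoint. -/
lemma IsTrajectoryOn.concat {n : ℕ} {F : Vec n → Vec n} {T τ : ℝ} {x z : ℝ → Vec n}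
    (hT : 0 < T) (hx : IsTrajectoryOn F (Ico 0 T) x) (hz : IsTrajectoryOn F (Ico 0 τ) z)
    (hlim : Tendsto x (𝓝[<] T) (𝓝 (z 0))) (hF : z 0 ≠ 0 → ContinuousAt F (z 0)) :
    IsTrajectoryOn F (Ico 0 (T + τ)) (fun t => if t < T then x t else z (t - T)) := by
  set y : ℝ → Vec n := fun t => if t < T then x t else z (t - T) with hy
  have hyl : ∀ t, t < T → y t = x t := fun t ht => by simp [hy, ht]
  have hyr : ∀ t, T ≤ t → y t = z (t - T) := fun t ht => by simp [hy, not_lt.2 ht]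
  have hleft : EqOn y x (Ico 0 T) := fun t ht => hyl t ht.2
  have hyT : y T = z 0 := by simp [hy]
  have hmaps : MapsTo (fun t => t - T) (Ico T (T + τ)) (Ico 0 τ) := fun t ht =>
    ⟨sub_nonneg.2 ht.1, by have := ht.2; linarith⟩
  have hrc : ContinuousOn y (Ico T (T + τ)) :=
    (hz.continuousOn.comp (by fun_prop) hmaps).congr fun t ht => hyr t ht.1
  have hrd : ∀ t ∈ Ico T (T + τ), y t ≠ 0 → HasDerivWithinAt y (F (y t)) (Ico T (T + τ)) t := by
    intro t ht h0
    rw [hyr t ht.1] at h0 ⊢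
    have h1 := (hz.hasDeriv (t - T) (hmaps ht) h0).scomp t
      ((hasDerivAt_id t).sub_const T).hasDerivWithinAt hmaps
    rw [one_smul] at h1
    exact h1.congr (fun s hs => hyr s hs.1) (hyr t ht.1)
  have hcT : ContinuousWithinAt y (Iio T) T := by
    rw [ContinuousWithinAt, hyT]
    exact hlim.congr' (eventually_nhdsWithin_of_forall fun t ht => (hyl t ht).symm)
  have hcases : ∀ t ∈ Ico 0 (T + τ), t < T ∨ (t = T ∧ 0 < τ) ∨ (T < t ∧ 0 < τ) := by
    intro t ht
    rcases lt_trichotomy t T with h | h | h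
    · exact .inl h
    · exact .inr (.inl ⟨h, by linarith [ht.2]⟩)
    · exact .inr (.inr ⟨h, by linarith [ht.2]⟩)
  have hn1 : ∀ t, t < T → Ico 0 T ∈ 𝓝[Ico 0 (T + τ)] t := fun t ht =>
    mem_nhdsWithin.2 ⟨Iio T, isOpen_Iio, ht, fun s hs => ⟨hs.2.1, hs.1⟩⟩
  have hn2 : ∀ t, T < t → Ico T (T + τ) ∈ 𝓝[Ico 0 (T + τ)] t := fun t ht =>
    mem_nhdsWithin.2 ⟨Ioi T, isOpen_Ioi, ht, fun s hs => ⟨le_of_lt hs.1, hs.2.2⟩⟩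
  have hn3 : Iio T ∪ Ico T (T + τ) ∈ 𝓝[Ico 0 (T + τ)] T :=
    mem_of_superset self_mem_nhdsWithin fun s hs => by
      rcases lt_or_ge s T with h | h
      · exact .inl h
      · exact .inr ⟨h, hs.2⟩
  constructor
  · intro t ht
    rcases hcases t ht with h | ⟨rfl, hτ⟩ | ⟨h, -⟩
    · exact ((hx.continuousOn t ⟨ht.1, h⟩).congr hleft
        (hyl t h)).mono_of_mem_nhdsWithin (hn1 t h)
    · exact (hcT.union (hrc t ⟨le_rfl, ht.2⟩)).mono_of_mem_nhdsWithin hn3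
    · exact (hrc t ⟨h.le, ht.2⟩).mono_of_mem_nhdsWithin (hn2 t h)
  · intro t ht h0
    rcases hcases t ht with h | ⟨rfl, hτ⟩ | ⟨h, -⟩
    · rw [hyl t h] at h0 ⊢
      exact ((hx.hasDeriv t ⟨ht.1, h⟩ h0).congr hleft
        (hyl t h)).mono_of_mem_nhdsWithin (hn1 t h)
    · refine HasDerivWithinAt.mono_of_mem_nhdsWithin ?_ hn3
      refine HasDerivWithinAt.union ?_ (hrd t ⟨le_rfl, ht.2⟩ h0)
      rw [hyT] at h0 ⊢
      have hne : ∀ᶠ s in 𝓝[<] t, x s ≠ 0 := hlim.eventually_ne h0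
      have hpos : ∀ᶠ s in 𝓝[<] t, s ∈ Ioo 0 t := Ioo_mem_nhdsLT hT
      have hder : ∀ s ∈ Ioo 0 t, x s ≠ 0 → HasDerivAt y (F (x s)) s := fun s hs hs0 =>
        (hx.hasDerivAt hs.1 hs.2 hs0).congr_of_eventuallyEq
          (eventually_of_mem (Iio_mem_nhds hs.2) hyl)
      -- The left derivative at the junction is the limit of the derivatives before it, which exists
      -- because `F` is continuous at the nonzero limit point.
      refine (hasDerivWithinAt_Iic_of_tendsto_deriv (s := {s | s ∈ Ioo 0 t ∧ x s ≠ 0}) ?_ ?_ ?_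
        ?_).mono Iio_subset_Iic_self
      · exact fun s hs => (hder s hs.1 hs.2).differentiableAt.differentiableWithinAt
      · exact hcT.mono fun s hs => hs.1.2
      · exact hpos.and hne
      · refine ((hF h0).tendsto.comp hlim).congr' ?_
        filter_upwards [hpos, hne] with s hs hs0
        exact (hder s hs hs0).deriv.symm
    · exact (hrd t ⟨h.le, ht.2⟩ h0).mono_of_mem_nhdsWithin (hn2 t h)

/-- Local existence of solutions for a vector field that is Lipschitz near the initial value. -/
lemma exists_trajectory_of_lipschitzOnWith {n : ℕ} {F : Vec n → Vec n} {p : Vec n}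
    (hF : ∃ K, ∃ s ∈ 𝓝 p, LipschitzOnWith K F s) :
    ∃ τ, 0 < τ ∧ ∃ z, IsTrajectoryOn F (Ico 0 τ) z ∧ z 0 = p := by
  obtain ⟨K, s, hs, hK⟩ := hF
  obtain ⟨a, ha, has⟩ := Metric.nhds_basis_closedBall.mem_iff.1 hs
  lift a to NNReal using ha.le
  have hK' := hK.mono has
  -- A speed bound on the ball of radius `a`, so that solutions stay in it for time `a / L`; the `1`
  -- keeps `L` positive.
  set L : NNReal := ‖F p‖₊ + K * a + 1 with hL
  have hL1 : (1 : ℝ) ≤ L := by rw [hL]; push_cast; nlinarith [norm_nonneg (F p), mul_nonneg K.2 a.2]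
  have hLpos : (0 : ℝ) < L := by linarith
  have hbd : ∀ x ∈ Metric.closedBall p a, ‖F x‖ ≤ L := by
    intro x hx
    have h1 := hK'.dist_le_mul x hx p (Metric.mem_closedBall_self a.2)
    have h2 : dist x p ≤ a := hx
    have h3 : ‖F x‖ ≤ ‖F p‖ + dist (F x) (F p) := by
      rw [dist_eq_norm]
      calc ‖F x‖ = ‖F p + (F x - F p)‖ := by congr 1; abel
        _ ≤ _ := norm_add_le _ _
    have h4 : (K : ℝ) * dist x p ≤ K * a := mul_le_mul_of_nonneg_left h2 K.2
    rw [hL]; push_cast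
    linarith
  have hτ : (0 : ℝ) < (a : ℝ) / L := div_pos ha hLpos
  have hPL : IsPicardLindelof (fun _ => F) (tmin := 0) (tmax := (a : ℝ) / L) ⟨0, le_rfl, hτ.le⟩ p
      a 0 L K := by
    refine .of_time_independent hbd hK' ?_
    have : max ((a : ℝ) / L - 0) ((0 : ℝ) - 0) = a / L := by simp [hτ.le]
    rw [this, NNReal.coe_zero, sub_zero, mul_div_cancel₀ _ hLpos.ne']
  obtain ⟨z, hz0, hz⟩ := hPL.exists_eq_forall_mem_Icc_hasDerivWithinAt₀
  exact ⟨(a : ℝ) / L, hτ, z, ⟨fun t ht => ((hz t ⟨ht.1, ht.2.le⟩).continuousWithinAt).mono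
    Ico_subset_Icc_self, fun t ht _ => (hz t ⟨ht.1, ht.2.le⟩).mono Ico_subset_Icc_self⟩, hz0⟩

/-! ### Invariance, continuation and convergence from a certificate. -/

namespace ClosedLoopCertificate

variable {n : ℕ} {F : Vec n → Vec n} {C : Set (Vec n)} {V W h : Vec n → ℝ}

lemma isClosed (H : ClosedLoopCertificate F C V W h) : IsClosed C := by
  rw [H.set_eq]
  exact isClosed_le continuous_const H.h_contDiff.continuous

lemma V_nonneg (H : ClosedLoopCertificate F C V W h) (x : Vec n) : 0 ≤ V x := by
  by_cases hx : x = 0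
  · rw [hx, H.V_posDef.1]
  · exact (H.V_posDef.2 x hx).le

lemma eq_zero_of_V_nonpos (H : ClosedLoopCertificate F C V W h) {x : Vec n} (hx : V x ≤ 0) :
    x = 0 := by
  by_contra h0
  exact absurd (H.V_posDef.2 x h0) (not_lt.2 hx)

/-- Trajectories do not leave the safe set. -/
lemma mem_of_trajectory (H : ClosedLoopCertificate F C V W h) {T : ℝ} {x : ℝ → Vec n}
    (hx : IsTrajectoryOn F (Ico 0 T) x) (h0 : x 0 ∈ C) : ∀ t ∈ Ico 0 T, x t ∈ C := by
  intro t₁ ht₁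
  by_contra hout
  have hcont : ContinuousOn x (Icc 0 t₁) :=
    hx.continuousOn.mono fun s hs => ⟨hs.1, hs.2.trans_lt ht₁.2⟩
  -- the last time up to which the trajectory stays in `C`
  set A : Set ℝ := {s | s ∈ Icc 0 t₁ ∧ ∀ r ∈ Icc 0 s, x r ∈ C} with hA
  have hA0 : (0 : ℝ) ∈ A := ⟨⟨le_rfl, ht₁.1⟩, fun r hr => by
    rwa [le_antisymm hr.2 hr.1]⟩
  have hAb : BddAbove A := ⟨t₁, fun s hs => hs.1.2⟩
  set s := sSup A
  have hs0 : 0 ≤ s := le_csSup hAb hA0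
  have hs1 : s ≤ t₁ := csSup_le ⟨0, hA0⟩ fun r hr => hr.1.2
  have hbefore : ∀ r ∈ Ico 0 s, x r ∈ C := by
    intro r hr
    obtain ⟨q, hq, hrq⟩ := exists_lt_of_lt_csSup ⟨0, hA0⟩ hr.2
    exact hq.2 r ⟨hr.1, hrq.le⟩
  have hsC : x s ∈ C := by
    rcases hs0.eq_or_lt with h | h
    · rwa [← h]
    · have hc := (hcont s ⟨hs0, hs1⟩).mono (Ico_subset_Icc_self.trans (Icc_subset_Icc_right hs1))
      have : (𝓝[Ico 0 s] s).NeBot := by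
        rw [← mem_closure_iff_nhdsWithin_neBot, closure_Ico h.ne]
        exact ⟨hs0, le_rfl⟩
      exact H.isClosed.mem_of_tendsto hc (eventually_nhdsWithin_of_forall hbefore)
  have hlt : s < t₁ := lt_of_le_of_ne hs1 fun h => hout (h ▸ hsC)
  -- just after that time the trajectory is near a point of `C`
  have hev : ∀ᶠ t in 𝓝[Icc 0 t₁] s, h (x t) < 0 → 0 < ⟪∇ h (x t), F (x t)⟫_ℝ :=
    (hcont s ⟨hs0, hs1⟩).eventually (H.barrier (x s) hsC)
  obtain ⟨ε, hε, hball⟩ := Metric.mem_nhdsWithin_iff.1 hev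
  set b := min t₁ (s + ε / 2)
  have hsb : s < b := lt_min hlt (by linarith)
  have hbt : b ≤ t₁ := min_le_left _ _
  have hnear : ∀ t ∈ Icc s b, h (x t) < 0 → 0 < ⟪∇ h (x t), F (x t)⟫_ℝ := by
    intro t ht
    refine hball ⟨?_, hs0.trans ht.1, ht.2.trans hbt⟩
    rw [Metric.mem_ball, Real.dist_eq, abs_of_nonneg (sub_nonneg.2 ht.1)]
    have := ht.2.trans (min_le_right t₁ (s + ε / 2))
    linarith
  have hh0 : 0 ≤ h 0 := by have := H.zero_mem; rwa [H.set_eq] at this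
  have hstay : ∀ r ∈ Icc s b, x r ∈ C := by
    intro r hr
    rw [H.set_eq]
    have key : -h (x r) ≤ 0 := by
      refine le_of_hasDerivAt_nonpos_of_gt (φ := fun t => -h (x t))
        (φ' := fun t => -⟪∇ h (x t), F (x t)⟫_ℝ) hr.1 ?_ ?_ ?_
      · exact (H.h_contDiff.continuous.comp_continuousOn (hcont.mono
          (Icc_subset_Icc hs0 (hr.2.trans hbt)))).neg
      · rw [H.set_eq] at hsC
        exact neg_nonpos.2 hsC
      · intro t ht hpos
        have hneg : h (x t) < 0 := by simpa using hpos
        -- Outside `C` the trajectory is not at the origin, so the differential equation is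
        -- available.
        have hne : x t ≠ 0 := fun h0 => by rw [h0] at hneg; linarith
        have htb : t ≤ b := ht.2.le.trans hr.2
        have hd := hx.hasDerivAt (hs0.trans_lt ht.1) ((htb.trans hbt).trans_lt ht₁.2) hne
        refine ⟨?_, by have := hnear t ⟨ht.1.le, htb⟩ hneg; linarith⟩
        have := hasDerivWithinAt_comp_gradient H.h_contDiff hd.hasDerivWithinAt (s := univ)
        exact (hasDerivWithinAt_univ.1 this).neg
    exact neg_nonpos.1 key
  have hbA : b ∈ A := by
    refine ⟨⟨hs0.trans hsb.le, hbt⟩, fun r hr => ?_⟩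
    rcases lt_or_ge r s with h | h
    · exact hbefore r ⟨hr.1, h⟩
    · exact hstay r ⟨h, hr.2⟩
  exact absurd (le_csSup hAb hbA) (not_le.2 hsb)

lemma hasDerivAt_V (H : ClosedLoopCertificate F C V W h) {T : ℝ} {x : ℝ → Vec n}
    (hx : IsTrajectoryOn F (Ico 0 T) x) {t : ℝ} (ht : t ∈ Ioo 0 T) (hne : x t ≠ 0) :
    HasDerivAt (fun t => V (x t)) ⟪∇ V (x t), F (x t)⟫_ℝ t :=
  hasDerivWithinAt_univ.1 (hasDerivWithinAt_comp_gradient H.V_contDiff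
    (hx.hasDerivAt ht.1 ht.2 hne).hasDerivWithinAt (s := univ))

/-- The Lyapunov function is nonincreasing along trajectories. -/
lemma antitoneOn_V (H : ClosedLoopCertificate F C V W h) {T : ℝ} {x : ℝ → Vec n}
    (hx : IsTrajectoryOn F (Ico 0 T) x) (h0 : x 0 ∈ C) :
    AntitoneOn (fun t => V (x t)) (Ico 0 T) := by
  intro a ha b hb hab
  refine le_of_hasDerivAt_nonpos_of_gt (φ := fun t => V (x t))
    (φ' := fun t => ⟪∇ V (x t), F (x t)⟫_ℝ) hab ?_ le_rfl ?_
  · exact H.V_contDiff.continuous.comp_continuousOn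
      (hx.continuousOn.mono fun s hs => ⟨ha.1.trans hs.1, hs.2.trans_lt hb.2⟩)
  · intro t ht hpos
    have hne : x t ≠ 0 := fun h0 => by
      have := H.V_nonneg (x a)
      rw [h0, H.V_posDef.1] at hpos
      linarith
    have htT : t ∈ Ioo 0 T := ⟨ha.1.trans_lt ht.1, ht.2.trans hb.2⟩
    have h1 := H.decrease (x t) ⟨H.mem_of_trajectory hx h0 t ⟨htT.1.le, htT.2⟩, hne⟩
    have h2 := H.W_posDef.2 _ hne
    exact ⟨H.hasDerivAt_V hx htT hne, by linarith⟩

/-- A positive lower bound of a function that is positive away from the origin, on a sublevel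
set of `V` in `C` away from the origin. -/
lemma exists_pos_lower_bound (H : ClosedLoopCertificate F C V W h) {f : Vec n → ℝ}
    (hf : Continuous f) (hpos : ∀ x, x ≠ 0 → 0 < f x) {U : Set (Vec n)} (hU : IsOpen U)
    (h0 : (0 : Vec n) ∈ U) (c : ℝ) :
    ∃ w, 0 < w ∧ ∀ x ∈ C, V x ≤ c → x ∉ U → w ≤ f x := by
  have hK : IsCompact ({x | x ∈ C ∧ V x ≤ c} \ U) := (H.proper c).diff hU
  rcases ({x | x ∈ C ∧ V x ≤ c} \ U).eq_empty_or_nonempty with he | hne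
  · refine ⟨1, one_pos, fun x hx hxc hxU => ?_⟩
    have : x ∈ ({x | x ∈ C ∧ V x ≤ c} \ U) := ⟨⟨hx, hxc⟩, hxU⟩
    rw [he] at this
    exact this.elim
  · obtain ⟨p, hp, hmin⟩ := hK.exists_isMinOn hne hf.continuousOn
    exact ⟨f p, hpos p fun h => hp.2 (h ▸ h0), fun x hx hxc hxU => hmin ⟨⟨hx, hxc⟩, hxU⟩⟩

/-- Off any neighborhood of the origin, `V` has a positive lower bound on the compact set `C ∩ {V ≤
1}`; the level `1` is arbitrary. -/
lemma tendsto_zero_of_V (H : ClosedLoopCertificate F C V W h) {l : Filter ℝ} {x : ℝ → Vec n}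
    (hC : ∀ᶠ t in l, x t ∈ C) (hV : Tendsto (fun t => V (x t)) l (𝓝 0)) :
    Tendsto x l (𝓝 0) := by
  refine (nhds_basis_opens (0 : Vec n)).tendsto_right_iff.2 fun U hU => ?_
  obtain ⟨w, hw, hwU⟩ :=
    H.exists_pos_lower_bound H.V_contDiff.continuous H.V_posDef.2 hU.2 hU.1 1
  filter_upwards [hC, hV.eventually (gt_mem_nhds hw), hV.eventually (gt_mem_nhds one_pos)]
    with t h1 h2 h3
  by_contra hxU
  exact absurd (hwU (x t) h1 h3.le hxU) (not_le.2 h2)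

/-- A trajectory on a bounded interval has a limit at its right end. -/
lemma exists_tendsto (H : ClosedLoopCertificate F C V W h) {T : ℝ} (hT : 0 < T)
    {x : ℝ → Vec n} (hx : IsTrajectoryOn F (Ico 0 T) x) (h0 : x 0 ∈ C) :
    ∃ p ∈ C, Tendsto x (𝓝[<] T) (𝓝 p) := by
  have hmem := H.mem_of_trajectory hx h0
  have hanti := H.antitoneOn_V hx h0
  have hevI : ∀ᶠ t in 𝓝[<] T, t ∈ Ico 0 T := Ico_mem_nhdsLT hT
  -- If `V` stays above some `ε > 0`, the trajectory remains in a compact set without the origin,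
  -- where `F` is bounded, so it is Lipschitz in time and has a limit. Otherwise monotonicity forces
  -- `V → 0`, and the limit is the origin.
  by_cases hlow : ∃ ε > 0, ∀ t ∈ Ico 0 T, ε ≤ V (x t)
  · obtain ⟨ε, hε, hlow⟩ := hlow
    set K : Set (Vec n) := {y | y ∈ C ∧ V y ≤ V (x 0)} ∩ {y | ε ≤ V y} with hKdef
    have hK : IsCompact K := (H.proper _).inter_right
      (isClosed_le continuous_const H.V_contDiff.continuous)
    have hK0 : ∀ y ∈ K, y ≠ 0 := fun y hy h => by
      have : ε ≤ V y := hy.2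
      rw [h, H.V_posDef.1] at this
      linarith
    have hxK : ∀ t ∈ Ico 0 T, x t ∈ K := fun t ht =>
      ⟨⟨hmem t ht, hanti ⟨le_rfl, hT⟩ ht ht.1⟩, hlow t ht⟩
    have hFK : ContinuousOn F K := fun y hy => by
      obtain ⟨L, s, hs, hL⟩ := H.lipschitz y (hK0 y hy)
      exact (hL.continuousOn.continuousAt hs).continuousWithinAt
    obtain ⟨M, hM⟩ := hK.exists_bound_of_continuousOn hFK
    have hM0 : 0 ≤ M := (norm_nonneg _).trans (hM _ (hxK 0 ⟨le_rfl, hT⟩))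
    have hlip : ∀ a ∈ Ico 0 T, ∀ b ∈ Ico 0 T, ‖x b - x a‖ ≤ M * ‖b - a‖ := fun a ha b hb =>
      (convex_Ico 0 T).norm_image_sub_le_of_norm_hasDerivWithin_le
        (fun t ht => hx.hasDeriv t ht (hK0 _ (hxK t ht))) (fun t ht => hM _ (hxK t ht)) ha hb
    have hcauchy : Cauchy (map x (𝓝[<] T)) := by
      refine Metric.cauchy_iff.2 ⟨inferInstance, fun ε hε => ?_⟩
      -- `M + 1` rather than `M`, since `M` may vanish.
      set d := ε / (M + 1)
      have hd : 0 < d := by positivity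
      refine ⟨x '' (Ico 0 T ∩ Ioo (T - d) T), image_mem_map ?_, ?_⟩
      · exact inter_mem hevI (Ioo_mem_nhdsLT (by linarith))
      · rintro _ ⟨a, ha, rfl⟩ _ ⟨b, hb, rfl⟩
        rw [dist_comm, dist_eq_norm]
        refine (hlip a ha.1 b hb.1).trans_lt ?_
        have h1 : ‖b - a‖ ≤ d := by
          rw [Real.norm_eq_abs, abs_le]
          constructor <;> linarith [ha.2.1, ha.2.2, hb.2.1, hb.2.2]
        calc M * ‖b - a‖ ≤ M * d := by gcongr
          _ < (M + 1) * d := by linarith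
          _ = ε := mul_div_cancel₀ _ (by positivity)
    obtain ⟨p, hp⟩ := CompleteSpace.complete hcauchy
    have hp' : Tendsto x (𝓝[<] T) (𝓝 p) := hp
    exact ⟨p, H.isClosed.mem_of_tendsto hp' (hevI.mono hmem), hp'⟩
  · push Not at hlow
    refine ⟨0, H.zero_mem, H.tendsto_zero_of_V (hevI.mono hmem) ?_⟩
    refine tendsto_order.2 ⟨fun a ha => .of_forall fun t => ha.trans_le (H.V_nonneg _),
      fun a ha => ?_⟩
    obtain ⟨t, ht, hta⟩ := hlow a ha
    filter_upwards [Ico_mem_nhdsLT ht.2] with r hr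
    exact (hanti ht ⟨ht.1.trans hr.1, hr.2⟩ hr.1).trans_lt hta

/-- A trajectory on a bounded interval can be continued beyond it. -/
lemma exists_extension (H : ClosedLoopCertificate F C V W h) {T : ℝ} (hT : 0 < T)
    {x : ℝ → Vec n} (hx : IsTrajectoryOn F (Ico 0 T) x) (h0 : x 0 ∈ C) :
    ∃ T', T < T' ∧ ∃ y, IsTrajectoryOn F (Ico 0 T') y ∧ EqOn x y (Ico 0 T) := by
  obtain ⟨p, hp, hlim⟩ := H.exists_tendsto hT hx h0
  obtain ⟨τ, hτ, z, hz, hzp⟩ :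
      ∃ τ, 0 < τ ∧ ∃ z, IsTrajectoryOn F (Ico 0 τ) z ∧ z 0 = p := by
    by_cases hp0 : p = 0
    · exact ⟨1, one_pos, fun _ => 0, isTrajectoryOn_zero F _, hp0.symm⟩
    · exact exists_trajectory_of_lipschitzOnWith (H.lipschitz p hp0)
  refine ⟨T + τ, by linarith, _, hx.concat hT hz (by rwa [hzp]) fun hne => ?_, fun t ht => ?_⟩
  · obtain ⟨L, s, hs, hL⟩ := H.lipschitz _ hne
    exact hL.continuousOn.continuousAt hs
  · simp [ht.2]

/-- A trajectory on a bounded interval can be continued for all times. -/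
lemma exists_global_extension (H : ClosedLoopCertificate F C V W h) {T₀ : ℝ} (hT₀ : 0 < T₀)
    {x₀ : ℝ → Vec n} (hx₀ : IsTrajectoryOn F (Ico 0 T₀) x₀) (h0 : x₀ 0 ∈ C) :
    ∃ y, IsTrajectoryOn F (Ici 0) y ∧ EqOn x₀ y (Ico 0 T₀) := by
  by_contra hno
  -- Zorn's lemma on the extensions to bounded intervals, ordered by continuation. Members of a
  -- chain agree where both are defined, so no uniqueness theorem is needed.
  let α := {q : ℝ × (ℝ → Vec n) // T₀ ≤ q.1 ∧ IsTrajectoryOn F (Ico 0 q.1) q.2 ∧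
    EqOn x₀ q.2 (Ico 0 T₀)}
  let r : α → α → Prop := fun p q => p.1.1 ≤ q.1.1 ∧ EqOn p.1.2 q.1.2 (Ico 0 p.1.1)
  have hchain : ∀ c : Set α, IsChain r c → ∃ ub, ∀ a ∈ c, r a ub := by
    intro c hc
    rcases c.eq_empty_or_nonempty with rfl | ⟨a₀, ha₀⟩
    · exact ⟨⟨(T₀, x₀), le_rfl, hx₀, fun _ _ => rfl⟩, fun a ha => ha.elim⟩
    have hagree : ∀ a ∈ c, ∀ b ∈ c, ∀ t, 0 ≤ t → t < a.1.1 → t < b.1.1 →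
        a.1.2 t = b.1.2 t := by
      intro a ha b hb t ht hta htb
      by_cases hab : a = b
      · rw [hab]
      · rcases hc ha hb hab with h | h
        · exact h.2 ⟨ht, hta⟩
        · exact (h.2 ⟨ht, htb⟩).symm
    classical
    let y : ℝ → Vec n := fun t => if ht : ∃ a ∈ c, t < a.1.1 then ht.choose.1.2 t else 0
    have hy : ∀ a ∈ c, EqOn a.1.2 y (Ico 0 a.1.1) := by
      intro a ha t ht
      have hex : ∃ a ∈ c, t < a.1.1 := ⟨a, ha, ht.2⟩
      simp only [y, dif_pos hex]
      exact hagree a ha _ hex.choose_spec.1 t ht.1 ht.2 hex.choose_spec.2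
    have htraj : ∀ I : Set ℝ, I ⊆ Ici 0 → (∀ t ∈ I, ∃ a ∈ c, t < a.1.1) →
        IsTrajectoryOn F I y := by
      intro I hI hcov
      refine .of_local fun t ht => ?_
      obtain ⟨a, ha, hta⟩ := hcov t ht
      exact ⟨Ico 0 a.1.1, mem_nhdsWithin.2 ⟨Iio a.1.1, isOpen_Iio, hta, fun s hs =>
        ⟨hI hs.2, hs.1⟩⟩, a.1.2, ⟨hI ht, hta⟩, a.2.2.1, (hy a ha).symm⟩
    have hyx : EqOn x₀ y (Ico 0 T₀) := fun t ht =>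
      (a₀.2.2.2 ht).trans (hy a₀ ha₀ ⟨ht.1, ht.2.trans_le a₀.2.1⟩)
    by_cases hbdd : BddAbove ((fun a : α => a.1.1) '' c)
    · set T := sSup ((fun a : α => a.1.1) '' c)
      have hle : ∀ a ∈ c, a.1.1 ≤ T := fun a ha => le_csSup hbdd ⟨a, ha, rfl⟩
      have htr := htraj (Ico 0 T) (fun t ht => ht.1) fun t ht => by
        obtain ⟨_, ⟨a, ha, rfl⟩, hta⟩ := exists_lt_of_lt_csSup
          (show ((fun a : α => a.1.1) '' c).Nonempty from ⟨_, a₀, ha₀, rfl⟩) ht.2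
        exact ⟨a, ha, hta⟩
      exact ⟨⟨(T, y), a₀.2.1.trans (hle a₀ ha₀), htr, hyx⟩, fun a ha => ⟨hle a ha, hy a ha⟩⟩
    -- A chain with unbounded end times would glue to a global trajectory, which `hno` excludes.
    · refine absurd ⟨y, htraj (Ici 0) Subset.rfl fun t _ => ?_, hyx⟩ hno
      obtain ⟨_, ⟨a, ha, rfl⟩, hta⟩ := not_bddAbove_iff.1 hbdd t
      exact ⟨a, ha, hta⟩
  have htrans : ∀ {a b c : α}, r a b → r b c → r a c := fun {a b c} hab hbc =>
    ⟨hab.1.trans hbc.1, fun t ht => (hab.2 ht).trans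
      (hbc.2 (show t ∈ Ico 0 b.1.1 from ⟨ht.1, ht.2.trans_le hab.1⟩))⟩
  obtain ⟨m, hm⟩ := exists_maximal_of_chains_bounded hchain htrans
  have hmC : m.1.2 0 ∈ C := by rwa [← m.2.2.2 ⟨le_rfl, hT₀⟩]
  obtain ⟨T', hT', y, hy, hxy⟩ := H.exists_extension (hT₀.trans_le m.2.1) m.2.2.1 hmC
  have hy₀ : EqOn x₀ y (Ico 0 T₀) := fun t ht =>
    (m.2.2.2 ht).trans (hxy ⟨ht.1, ht.2.trans_le m.2.1⟩)
  have := hm ⟨(T', y), m.2.1.trans hT'.le, hy, hy₀⟩ ⟨hT'.le, hxy⟩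
  exact absurd this.1 (not_le.2 hT')

/-- Trajectories converge to the origin. -/
lemma tendsto_zero (H : ClosedLoopCertificate F C V W h) {x : ℝ → Vec n}
    (hx : IsTrajectoryOn F (Ici 0) x) (h0 : x 0 ∈ C) : Tendsto x atTop (𝓝 0) := by
  have hres : ∀ T, IsTrajectoryOn F (Ico 0 T) x := fun T => hx.mono Ico_subset_Ici_self
  have hmem : ∀ t, 0 ≤ t → x t ∈ C := fun t ht =>
    H.mem_of_trajectory (hres (t + 1)) h0 t ⟨ht, by linarith⟩
  have hanti : AntitoneOn (fun t => V (x t)) (Ici 0) := fun a ha b hb hab =>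
    H.antitoneOn_V (hres (b + 1)) h0 ⟨ha, by linarith⟩ ⟨hb, by linarith⟩ hab
  refine H.tendsto_zero_of_V ((eventually_ge_atTop 0).mono hmem) ?_
  refine tendsto_order.2 ⟨fun a ha => .of_forall fun t => ha.trans_le (H.V_nonneg _),
    fun a ha => ?_⟩
  suffices ∃ t, 0 ≤ t ∧ V (x t) < a by
    obtain ⟨t, ht, hta⟩ := this
    filter_upwards [eventually_ge_atTop t] with r hr
    exact (hanti ht (ht.trans hr) hr).trans_lt hta
  by_contra! hlow
  obtain ⟨w, hw, hwb⟩ := H.exists_pos_lower_bound H.W_continuous H.W_posDef.2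
    (isOpen_lt H.V_contDiff.continuous continuous_const : IsOpen {y | V y < a})
    (by simpa [H.V_posDef.1] using ha) (V (x 0))
  have hwt : ∀ t, 0 ≤ t → w ≤ W (x t) := fun t ht =>
    hwb _ (hmem t ht) (hanti (le_refl (0 : ℝ)) ht ht) (not_lt.2 (hlow t ht))
  have hne : ∀ t, 0 ≤ t → x t ≠ 0 := fun t ht h => by
    have := hlow t ht
    rw [h, H.V_posDef.1] at this
    linarith
  have hdec : ∀ t, 0 ≤ t → V (x t) + w * t ≤ V (x 0) := by
    intro t ht
    refine le_of_hasDerivAt_nonpos_of_gt (φ := fun t => V (x t) + w * t)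
      (φ' := fun t => ⟪∇ V (x t), F (x t)⟫_ℝ + w) ht ?_ (by simp) ?_
    · exact (H.V_contDiff.continuous.comp_continuousOn
        (hx.continuousOn.mono Icc_subset_Ici_self)).add (by fun_prop)
    · intro s hs _
      have h1 := H.hasDerivAt_V (hres t) hs (hne s hs.1.le)
      have h2 := H.decrease (x s) ⟨hmem s hs.1.le, hne s hs.1.le⟩
      have h3 := hwt s hs.1.le
      refine ⟨?_, by linarith⟩
      have h4 := h1.add ((hasDerivAt_id s).const_mul w)
      rwa [mul_one] at h4
  -- At this time the decay `w * t` equals `V (x 0) + 1`, which would make `V` negative.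
  have h1 := hdec ((V (x 0) + 1) / w) (div_nonneg (by linarith [H.V_nonneg (x 0)]) hw.le)
  rw [mul_div_cancel₀ _ hw.ne'] at h1
  linarith [H.V_nonneg (x ((V (x 0) + 1) / w))]

theorem isSafeStabilized (H : ClosedLoopCertificate F C V W h) : IsSafeStabilized F C where
  exists_trajectory x₀ hx₀ := by
    by_cases h : x₀ = 0
    · exact ⟨fun _ => 0, isTrajectoryOn_zero F _, h.symm⟩
    · obtain ⟨τ, hτ, z, hz, hz0⟩ := exists_trajectory_of_lipschitzOnWith (H.lipschitz x₀ h)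
      obtain ⟨y, hy, hzy⟩ := H.exists_global_extension hτ hz (hz0 ▸ hx₀)
      exact ⟨y, hy, by rw [← hzy ⟨le_rfl, hτ⟩, hz0]⟩
  invariant T x _ hx h0 := H.mem_of_trajectory hx h0
  absorbing T x _ hx h0 s hs t ht hst hxs := by
    refine H.eq_zero_of_V_nonpos ?_
    have := H.antitoneOn_V hx h0 hs ht hst
    simpa [hxs, H.V_posDef.1] using this
  extends_global T x hT hx h0 := H.exists_global_extension hT hx h0
  tendsto_zero x hx h0 := H.tendsto_zero hx h0

end ClosedLoopCertificate

/-! ### Smooth selection. -/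

open scoped Manifold ContDiff in
/-- Smooth selection away from the origin from convex sets that locally contain constants. -/
lemma exists_smooth_selection {n m : ℕ} {t : Vec n → Set (Vec m)}
    (ht : ∀ x, x ≠ 0 → Convex ℝ (t x))
    (hloc : ∀ x, x ≠ 0 → ∃ c, ∀ᶠ y in 𝓝 x, y ≠ 0 → c ∈ t y) :
    ∃ k : Vec n → Vec m, k 0 = 0 ∧ (∀ x, x ≠ 0 → ContDiffAt ℝ (⊤ : ℕ∞) k x) ∧
      ∀ x, x ≠ 0 → k x ∈ t x := by
  classical
  let U : TopologicalSpace.Opens (Vec n) := ⟨{0}ᶜ, isOpen_compl_singleton⟩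
  have hU : ∀ x : U, (x : Vec n) ≠ 0 := fun x => x.2
  have : LocallyCompactSpace U := U.isOpen.locallyCompactSpace
  -- Partition of unity on the open submanifold `{0}ᶜ`; the value at the origin is filled in
  -- afterwards.
  obtain ⟨g, hg⟩ := exists_contMDiffMap_forall_mem_convex_of_local_const (𝓘(ℝ, Vec n))
    (M := U) (F := Vec m) (t := fun x : U => t x) (n := ⊤) (fun x => ht x (hU x)) fun x => by
      obtain ⟨c, hc⟩ := hloc x (hU x)
      refine ⟨c, ?_⟩
      have h1 : ∀ᶠ y : U in 𝓝 x, (y : Vec n) ≠ 0 → c ∈ t y :=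
        continuous_subtype_val.continuousAt.eventually hc
      exact h1.mono fun y hy => hy (hU y)
  let k : Vec n → Vec m := fun x => if hx : x ≠ 0 then g ⟨x, hx⟩ else 0
  have hk : ∀ y : U, k y = g y := fun y => by simp [k, hU y]
  refine ⟨k, by simp [k], fun x hx => ?_, fun x hx => hk ⟨x, hx⟩ ▸ hg ⟨x, hx⟩⟩
  have h1 : ContMDiffAt 𝓘(ℝ, Vec n) 𝓘(ℝ, Vec m) (⊤ : ℕ∞) (fun y : U => k y) ⟨x, hx⟩ :=
    g.contMDiff.contMDiffAt.congr_of_eventuallyEq (.of_forall hk)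
  exact ((contMDiffAt_subtype_iff (U := U) (f := k) (x := ⟨x, hx⟩)).1 h1).contDiffAt

/-! ### Strict second-order cone constraints: convex in the control, open in the state. -/

/-- The constraint holds with strict inequality. -/
def SOCC.HoldsStrictly {n m : ℕ} (q : SOCC n m) (x : Vec n) (u : Vec m) : Prop :=
  ‖Matrix.toEuclideanLin (q.Q x) u + q.r x‖ < ⟪q.b x, u⟫_ℝ + q.c x

lemma SOCC.HoldsStrictly.holds {n m : ℕ} {q : SOCC n m} {x : Vec n} {u : Vec m}
    (h : q.HoldsStrictly x u) : q.Holds x u :=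
  le_of_lt h

lemma SOCC.convex_holdsStrictly {n m : ℕ} (q : SOCC n m) (x : Vec n) :
    Convex ℝ {u | q.HoldsStrictly x u} := by
  intro u hu v hv a b ha hb hab
  simp only [mem_ofPred_eq, SOCC.HoldsStrictly] at hu hv ⊢
  set A := Matrix.toEuclideanLin (q.Q x)
  have h1 : A (a • u + b • v) + q.r x = a • (A u + q.r x) + b • (A v + q.r x) := by
    rw [map_add, map_smul, map_smul, smul_add, smul_add]
    nth_rewrite 1 [← one_smul ℝ (q.r x)]
    rw [← hab, add_smul]
    abel
  have h2 : ⟪q.b x, a • u + b • v⟫_ℝ + q.c x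
      = a * (⟪q.b x, u⟫_ℝ + q.c x) + b * (⟪q.b x, v⟫_ℝ + q.c x) := by
    rw [inner_add_right, inner_smul_right, inner_smul_right]
    linear_combination (-(q.c x)) * hab
  rw [h1, h2]
  refine (norm_add_le _ _).trans_lt ?_
  rw [norm_smul, norm_smul, Real.norm_of_nonneg ha, Real.norm_of_nonneg hb]
  -- Strictness is drawn from the `a` term, so `a = 0` is separate.
  rcases ha.eq_or_lt with rfl | ha'
  · have : b = 1 := by linarith
    simpa [this] using hv
  · exact add_lt_add_of_lt_of_le (mul_lt_mul_of_pos_left hu ha')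
      (mul_le_mul_of_nonneg_left hv.le hb)

lemma SOCC.ContOn.eventually_holdsStrictly {n m : ℕ} {q : SOCC n m} {s : Set (Vec n)}
    (hq : q.ContOn s) {x : Vec n} (hx : x ∈ s) {u : Vec m} (hu : q.HoldsStrictly x u) :
    ∀ᶠ y in 𝓝[s] x, q.HoldsStrictly y u := by
  have hQ : ContinuousOn (fun y => Matrix.toEuclideanLin (q.Q y) u) s := by
    have h1 : Continuous fun A : Matrix (Fin (m + 1)) (Fin m) ℝ =>
        WithLp.toLp 2 (A *ᵥ (WithLp.ofLp u)) := by fun_prop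
    exact h1.comp_continuousOn hq.Q_cont
  have hl : ContinuousOn (fun y => ‖Matrix.toEuclideanLin (q.Q y) u + q.r y‖) s :=
    (hQ.add hq.r_cont).norm
  have hr : ContinuousOn (fun y => ⟪q.b y, u⟫_ℝ + q.c y) s :=
    (hq.b_cont.inner continuousOn_const).add hq.c_cont
  exact (hl x hx).eventually_lt (hr x hx) hu

/-! ### Construction of the controller from compatible slacks. -/

section

variable {n m : ℕ} {sys : ControlSystem n m} {C Γ : Set (Vec n)} {V W S h B : Vec n → ℝ}
  {η : ℝ} {α ζ : ℝ → ℝ}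

lemma lieDeriv_eq (sys : ControlSystem n m) (V : Vec n → ℝ) (x : Vec n) (u : Vec m) :
    lieDeriv sys V x u = ⟪∇ V x, sys.f x + sys.g x u⟫_ℝ := by
  rw [lieDeriv, inner_add_right]

lemma continuous_lieDeriv (hf : Continuous sys.f) (hg : Continuous sys.g)
    (hV : ContDiff ℝ 1 V) (u : Vec m) : Continuous fun x => lieDeriv sys V x u := by
  have := continuous_gradient hV
  unfold lieDeriv
  fun_prop

/-- The drift term is constant in the control, so `lieDeriv` is affine there; this is why `a + b =
1` is needed. -/
lemma lieDeriv_combo (sys : ControlSystem n m) (V : Vec n → ℝ) (x : Vec n) (u v : Vec m)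
    {a b : ℝ} (hab : a + b = 1) :
    lieDeriv sys V x (a • u + b • v) = a * lieDeriv sys V x u + b * lieDeriv sys V x v := by
  simp only [lieDeriv, map_add, map_smul, inner_add_right, inner_smul_right]
  linear_combination (-⟪∇ V x, sys.f x⟫_ℝ) * hab

lemma convex_lieDeriv_lt (sys : ControlSystem n m) (V : Vec n → ℝ) (x : Vec n) (c : ℝ) :
    Convex ℝ {u | lieDeriv sys V x u < c} := by
  intro u hu v hv a b ha hb hab
  simp only [mem_ofPred_eq] at hu hv ⊢
  rw [lieDeriv_combo sys V x u v hab]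
  exact (convex_Iio c) hu hv ha hb hab

lemma convex_lt_lieDeriv (sys : ControlSystem n m) (V : Vec n → ℝ) (x : Vec n) (c : ℝ) :
    Convex ℝ {u | c < lieDeriv sys V x u} := by
  intro u hu v hv a b ha hb hab
  simp only [mem_ofPred_eq] at hu hv ⊢
  rw [lieDeriv_combo sys V x u v hab]
  exact (convex_Ioi c) hu hv ha hb hab

/-- A nonempty safe set contains the origin: a minimum of `V` on the safe set elsewhere would
contradict the compatibility of the constraints. -/
lemma zero_mem_of_compatible (hh : IsRobustCBF sys C h η α) (hV : IsCLF sys Γ V W)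
    (hCΓ : C ⊆ Γ) (hS : IsPosDefFun S) (hζ : IsClassKInf ζ)
    (hcompat : SlackCompatible sys C V W S h η α ζ B) (hne : C.Nonempty) :
    (0 : Vec n) ∈ C := by
  by_contra h0
  have hCcl : IsClosed C := by
    rw [hh.set_eq]
    exact isClosed_le continuous_const hh.contDiff.continuous
  obtain ⟨x₀, hx₀⟩ := hne
  have hV0 : 0 ≤ V x₀ := (hV.posDef.2 x₀ fun h => h0 (h ▸ hx₀)).le
  have hK : IsCompact ({x | x ∈ Γ ∧ V x ≤ V x₀} ∩ C) := (hV.proper _ hV0).inter_right hCcl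
  obtain ⟨p, ⟨⟨_, hp1⟩, hpC⟩, hmin⟩ := hK.exists_isMinOn ⟨x₀, ⟨hCΓ hx₀, le_rfl⟩, hx₀⟩
    hV.contDiff.continuous.continuousOn
  have hminC : ∀ y ∈ C, V p ≤ V y := fun y hy => by
    rcases le_total (V y) (V x₀) with hle | hle
    · exact hmin ⟨⟨hCΓ hy, hle⟩, hy⟩
    · exact hp1.trans hle
  have hp0 : p ≠ 0 := fun h => h0 (h ▸ hpC)
  obtain ⟨u, hu1, hu2, -⟩ := hcompat p hpC
  -- The velocity under a compatible control at the minimizer `p`. A short step along the ray `p + s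
  -- • v` lowers `V` and stays in `C`, contradicting minimality.
  set v := sys.f p + sys.g p u
  rw [lieDeriv_eq] at hu1 hu2
  have hcurve : HasDerivAt (fun s : ℝ => p + s • v) v 0 := by
    simpa using ((hasDerivAt_id (0 : ℝ)).smul_const v).const_add p
  have hdiff : ∀ {f : Vec n → ℝ}, ContDiff ℝ 1 f →
      HasDerivAt (fun s : ℝ => f (p + s • v)) ⟪∇ f p, v⟫_ℝ 0 := by
    intro f hf
    have := hasDerivWithinAt_comp_gradient hf (hcurve.hasDerivWithinAt (s := univ))
    simpa using hasDerivWithinAt_univ.1 this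
  have hVneg : ⟪∇ V p, v⟫_ℝ < 0 := by
    have := hS.2 p hp0
    have := hV.decay_posDef.2 p hp0
    linarith
  have hVdec : ∀ᶠ s in 𝓝[>] (0 : ℝ), V (p + s • v) < V p := by
    have := (hasDerivWithinAt_iff_tendsto_slope' (s := Ioi (0 : ℝ)) (by simp)).1
      (hdiff hV.contDiff).hasDerivWithinAt
    filter_upwards [this.eventually (gt_mem_nhds hVneg), self_mem_nhdsWithin] with s hs hs0
    rw [slope_def_field, div_lt_iff₀ (by simpa using hs0)] at hs
    simpa using hs
  have hCin : ∀ᶠ s in 𝓝[>] (0 : ℝ), p + s • v ∈ C := by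
    have hhp : 0 ≤ h p := by rwa [hh.set_eq] at hpC
    simp only [hh.set_eq, mem_ofPred_eq]
    -- On the boundary `α` and `ζ` vanish at `h p`, so `h` grows along `v` at rate at least `η`; in
    -- the interior continuity is enough.
    rcases hhp.eq_or_lt with hp | hp
    · have hpos : 0 < ⟪∇ h p, v⟫_ℝ := by
        rw [← hp, hζ.zero, hh.classKInf.zero] at hu2
        linarith [hh.eta_pos]
      have := (hasDerivWithinAt_iff_tendsto_slope' (s := Ioi (0 : ℝ)) (by simp)).1
        (hdiff hh.contDiff).hasDerivWithinAt
      filter_upwards [this.eventually (lt_mem_nhds hpos), self_mem_nhdsWithin] with s hs hs0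
      rw [slope_def_field, lt_div_iff₀ (by simpa using hs0)] at hs
      have : h p < h (p + s • v) := by simpa using hs
      exact hhp.trans this.le
    · have hc : ContinuousAt (fun s : ℝ => h (p + s • v)) 0 := (hdiff hh.contDiff).continuousAt
      have : ∀ᶠ s in 𝓝 (0 : ℝ), 0 < h (p + s • v) :=
        hc.eventually (lt_mem_nhds (by simpa using hp))
      exact (this.filter_mono nhdsWithin_le_nhds).mono fun s hs => hs.le
  obtain ⟨s, hs1, hs2⟩ := (hVdec.and hCin).exists
  exact absurd (hminC _ hs2) (not_le.2 hs1)

/-- The product `g k` is Lipschitz where `g` and `k` are both Lipschitz and bounded. Its role is to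
give local existence and continuity of the closed loop off the origin. -/
lemma closedLoop_lipschitz (hf : LocallyLipschitz sys.f) (hg : LocallyLipschitz sys.g)
    {k : Vec n → Vec m} {x : Vec n} (hk : ContDiffAt ℝ (⊤ : ℕ∞) k x) :
    ∃ K, ∃ s ∈ 𝓝 x, LipschitzOnWith K (sys.closedLoop k) s := by
  obtain ⟨Kf, sf, hsf, hLf⟩ := hf x
  obtain ⟨Kg, sg, hsg, hLg⟩ := hg x
  obtain ⟨Kk, sk, hsk, hLk⟩ := (hk.of_le (m := 1) (by exact_mod_cast le_top)).exists_lipschitzOnWith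
  have hgb : ∀ᶠ y in 𝓝 x, ‖sys.g y‖ < ‖sys.g x‖ + 1 :=
    hg.continuous.norm.continuousAt.eventually (gt_mem_nhds (by linarith))
  have hkb : ∀ᶠ y in 𝓝 x, ‖k y‖ < ‖k x‖ + 1 :=
    hk.continuousAt.norm.eventually (gt_mem_nhds (by linarith))
  refine ⟨Kf + (Kg * (‖k x‖₊ + 1) + (‖sys.g x‖₊ + 1) * Kk), _,
    inter_mem hsf (inter_mem hsg (inter_mem hsk (inter_mem hgb hkb))), ?_⟩
  refine LipschitzOnWith.of_dist_le_mul fun y hy z hz => ?_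
  have h1 := hLf.dist_le_mul y hy.1 z hz.1
  have h2 := hLg.dist_le_mul y hy.2.1 z hz.2.1
  have h3 := hLk.dist_le_mul y hy.2.2.1 z hz.2.2.1
  have h4 : ‖k y‖ ≤ ‖k x‖ + 1 := le_of_lt hy.2.2.2.2
  have h5 : ‖sys.g z‖ ≤ ‖sys.g x‖ + 1 := le_of_lt hz.2.2.2.1
  simp only [dist_eq_norm] at h1 h2 h3 ⊢
  have h6 : sys.closedLoop k y - sys.closedLoop k z
      = (sys.f y - sys.f z) + ((sys.g y - sys.g z) (k y) + sys.g z (k y - k z)) := by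
    simp only [ControlSystem.closedLoop, sub_apply, map_sub]
    abel
  rw [h6]
  push_cast
  calc _ ≤ ‖sys.f y - sys.f z‖ + (‖(sys.g y - sys.g z) (k y)‖ + ‖sys.g z (k y - k z)‖) :=
        (norm_add_le _ _).trans (by gcongr; exact norm_add_le _ _)
    _ ≤ Kf * ‖y - z‖ + ((Kg * ‖y - z‖) * (‖k x‖ + 1) + (‖sys.g x‖ + 1) * (Kk * ‖y - z‖)) := by
        gcongr
        · exact (ContinuousLinearMap.le_opNorm _ _).trans (by gcongr)
        · exact (ContinuousLinearMap.le_opNorm _ _).trans (by gcongr)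
    _ = _ := by ring

/-- If the controls provided by the compatibility of the constraints satisfy, on the safe set and
robustly in the state, further convex constraints `R`, then there is a safe stabilizing
controller with values in `R`, smooth away from the origin. -/
theorem exists_safe_stabilizing_controller
    (hf : LocallyLipschitz sys.f) (hg : LocallyLipschitz sys.g)
    (hh : IsRobustCBF sys C h η α) (hV : IsCLF sys Γ V W) (hCΓ : C ⊆ Γ)
    (hS : IsPosDefFun S) (hζ : IsClassKInf ζ)
    (hcompat : SlackCompatible sys C V W S h η α ζ B)
    (hαcont : ContinuousOn (fun x => α (h x)) C)
    (R : Vec n → Set (Vec m)) (hRconv : ∀ x, Convex ℝ (R x))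
    (hR : ∀ x ∈ C \ {0}, ∀ u : Vec m, lieDeriv sys V x u + W x ≤ -S x →
      η + ζ (h x) ≤ lieDeriv sys h x u + α (h x) → ‖u‖ ≤ B x →
      ∀ᶠ y in 𝓝[C \ {0}] x, u ∈ R y) :
    ∃ k : Vec n → Vec m, k 0 = 0 ∧ (∀ x, x ≠ 0 → ContDiffAt ℝ (⊤ : ℕ∞) k x) ∧
      IsSafeStabilized (sys.closedLoop k) C ∧ ∀ x ∈ C \ {0}, k x ∈ R x := by
  rcases C.eq_empty_or_nonempty with rfl | hne
  · exact ⟨fun _ => 0, rfl, fun x _ => contDiffAt_const,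
      ⟨fun _ h => h.elim, fun _ _ _ _ h => h.elim, fun _ _ _ _ h => h.elim,
        fun _ _ _ _ h => h.elim, fun _ _ h => h.elim⟩, fun x hx => hx.1.elim⟩
  have h0C := zero_mem_of_compatible hh hV hCΓ hS hζ hcompat hne
  have hVc := continuous_lieDeriv (V := V) hf.continuous hg.continuous hV.contDiff
  have hhc := continuous_lieDeriv (V := h) hf.continuous hg.continuous hh.contDiff
  have hCcl : IsClosed C := by
    rw [hh.set_eq]
    exact isClosed_le continuous_const hh.contDiff.continuous
  have hnonneg : ∀ x ∈ C, 0 ≤ h x := fun x hx => by rwa [hh.set_eq] at hx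
  have hζnn : ∀ x ∈ C, 0 ≤ ζ (h x) := fun x hx => by
    rw [← hζ.zero]
    exact hζ.strictMono.monotone (hnonneg x hx)
  obtain ⟨u₀, -, hu₀, -⟩ := hcompat 0 h0C
  -- near the origin, if it lies on the boundary, `h` can be made to increase
  obtain ⟨ρ, hρ, hρ1, hρ2⟩ : ∃ ρ, 0 < ρ ∧
      (h 0 = 0 → ∀ x ∈ Metric.closedBall (0 : Vec n) ρ, 0 < lieDeriv sys h x u₀) ∧
      (h 0 = 0 → ∀ x ∈ Metric.closedBall (0 : Vec n) ρ, x ∈ C → α (h x) < η) := by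
    by_cases hh0 : h 0 = 0
    · have h1 : 0 < lieDeriv sys h 0 u₀ := by
        rw [hh0, hζ.zero, hh.classKInf.zero] at hu₀
        linarith [hh.eta_pos]
      have h2 : ∀ᶠ x in 𝓝 (0 : Vec n), 0 < lieDeriv sys h x u₀ :=
        (hhc u₀).continuousAt.eventually (lt_mem_nhds h1)
      have h3 : ∀ᶠ x in 𝓝 (0 : Vec n), x ∈ C → α (h x) < η := by
        refine eventually_nhdsWithin_iff.1 ((hαcont 0 h0C).eventually (gt_mem_nhds ?_))
        change α (h 0) < η
        rw [hh0, hh.classKInf.zero]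
        exact hh.eta_pos
      obtain ⟨ρ, hρ, hball⟩ := Metric.nhds_basis_closedBall.mem_iff.1 (h2.and h3)
      exact ⟨ρ, hρ, fun _ x hx => (hball hx).1, fun _ x hx => (hball hx).2⟩
    · exact ⟨1, one_pos, fun h => absurd h hh0, fun h => absurd h hh0⟩
  -- The second condition is also imposed outside `C`. The controller may be discontinuous at `0`,
  -- so the growth of `h` near a boundary origin cannot be deduced from its behavior on `C`.
  let t : Vec n → Set (Vec m) := fun x => {u |
    (x ∈ C → lieDeriv sys V x u < -W x ∧ -α (h x) < lieDeriv sys h x u ∧ u ∈ R x) ∧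
    (h 0 = 0 → x ∈ Metric.closedBall (0 : Vec n) ρ → 0 < lieDeriv sys h x u)}
  have htconv : ∀ x, Convex ℝ (t x) := by
    intro x u hu v hv a b ha hb hab
    refine ⟨fun hx => ⟨?_, ?_, ?_⟩, fun hh0 hx => ?_⟩
    · exact convex_lieDeriv_lt sys V x _ (hu.1 hx).1 (hv.1 hx).1 ha hb hab
    · exact convex_lt_lieDeriv sys h x _ (hu.1 hx).2.1 (hv.1 hx).2.1 ha hb hab
    · exact hRconv x (hu.1 hx).2.2 (hv.1 hx).2.2 ha hb hab
    · exact convex_lt_lieDeriv sys h x _ (hu.2 hh0 hx) (hv.2 hh0 hx) ha hb hab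
  have htloc : ∀ x, x ≠ 0 → ∃ c, ∀ᶠ y in 𝓝 x, y ≠ 0 → c ∈ t y := by
    intro x hx0
    have hlift : ∀ u, (h 0 = 0 → x ∈ Metric.closedBall (0 : Vec n) ρ → 0 < lieDeriv sys h x u) →
        ∀ᶠ y in 𝓝 x, h 0 = 0 → y ∈ Metric.closedBall (0 : Vec n) ρ →
          0 < lieDeriv sys h y u := by
      intro u hu
      by_cases hxb : h 0 = 0 ∧ x ∈ Metric.closedBall (0 : Vec n) ρ
      · exact ((hhc u).continuousAt.eventually (lt_mem_nhds (hu hxb.1 hxb.2))).mono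
          fun y hy _ _ => hy
      · by_cases hh0 : h 0 = 0
        · have : (Metric.closedBall (0 : Vec n) ρ)ᶜ ∈ 𝓝 x :=
            Metric.isClosed_closedBall.isOpen_compl.mem_nhds fun hx => hxb ⟨hh0, hx⟩
          exact eventually_of_mem this fun y hy _ hyb => absurd hyb hy
        · exact .of_forall fun y h => absurd h hh0
    by_cases hxC : x ∈ C
    · obtain ⟨u, hu1, hu2, hu3⟩ := hcompat x hxC
      have hWx : lieDeriv sys V x u < -W x := by
        have := hS.2 x hx0
        linarith
      have hαx : -α (h x) < lieDeriv sys h x u := by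
        have := hζnn x hxC
        linarith [hh.eta_pos]
      have hxx : x ∈ C \ {0} := ⟨hxC, hx0⟩
      have e1 : ∀ᶠ y in 𝓝 x, lieDeriv sys V y u < -W y :=
        (hVc u).continuousAt.eventually_lt hV.decay_continuous.neg.continuousAt hWx
      have e2 : ∀ᶠ y in 𝓝[C] x, -α (h y) < lieDeriv sys h y u :=
        (hαcont x hxC).neg.eventually_lt (hhc u).continuousWithinAt hαx
      have e3 := eventually_nhdsWithin_iff.1 (hR x hxx u hu1 hu2 hu3)
      -- In the ball `α (h x) < η`, so the robust margin `η` alone makes the derivative of `h`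
      -- positive.
      have e4 := hlift u fun hh0 hxb => by
        have := hρ2 hh0 x hxb hxC
        have := hζnn x hxC
        linarith
      refine ⟨u, ?_⟩
      filter_upwards [e1, eventually_nhdsWithin_iff.1 e2, e3, e4] with y h1 h2 h3 h4 hy0
      exact ⟨fun hy => ⟨h1, h2 hy, h3 ⟨hy, hy0⟩⟩, h4⟩
    -- Off the closed set `C` only growth near the origin is required, and the control compatible at
    -- the origin provides it.
    · refine ⟨u₀, ?_⟩
      filter_upwards [hCcl.isOpen_compl.mem_nhds hxC, hlift u₀ fun hh0 hxb => hρ1 hh0 x hxb]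
        with y h1 h2 _
      exact ⟨fun hy => absurd hy h1, h2⟩
  obtain ⟨k, hk0, hksm, hkt⟩ := exists_smooth_selection (fun x _ => htconv x) htloc
  have hF : ∀ x, x ≠ 0 → ContinuousAt (sys.closedLoop k) x := fun x hx => by
    obtain ⟨K, s, hs, hL⟩ := closedLoop_lipschitz hf hg (hksm x hx)
    exact hL.continuousOn.continuousAt hs
  refine ⟨k, hk0, hksm, ?_, fun x hx => ((hkt x hx.2).1 hx.1).2.2⟩
  have hcert : ClosedLoopCertificate (sys.closedLoop k) C V W h :=
    { V_contDiff := hV.contDiff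
      h_contDiff := hh.contDiff
      set_eq := hh.set_eq
      zero_mem := h0C
      proper := fun c => by
        have h1 : IsCompact {x | x ∈ Γ ∧ V x ≤ max c 0} := hV.proper _ (le_max_right _ _)
        refine h1.of_isClosed_subset
          (hCcl.inter (isClosed_le hV.contDiff.continuous continuous_const)) fun x hx => ?_
        exact ⟨hCΓ hx.1, le_max_of_le_left hx.2⟩
      V_posDef := hV.posDef
      W_continuous := hV.decay_continuous
      W_posDef := hV.decay_posDef
      decrease := fun x hx => by
        have := ((hkt x hx.2).1 hx.1).1
        rw [lieDeriv_eq] at this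
        exact this.le
      barrier := fun x hx => by
        -- Boundary at the origin: the imposed growth. Boundary elsewhere: continuity of the closed
        -- loop. Interior: nearby states have `h > 0`.
        rcases (hnonneg x hx).eq_or_lt with hx0 | hx0
        · by_cases h : x = 0
          · subst h
            filter_upwards [Metric.closedBall_mem_nhds (0 : Vec n) hρ] with y hy hneg
            have hy0 : y ≠ 0 := fun h => by rw [h, ← hx0] at hneg; exact lt_irrefl _ hneg
            have := (hkt y hy0).2 hx0.symm hy
            rwa [lieDeriv_eq] at this
          · have h1 := ((hkt x h).1 hx).2.1
            rw [← hx0, hh.classKInf.zero, lieDeriv_eq, neg_zero] at h1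
            have h2 : ContinuousAt (fun y => ⟪∇ _ y, sys.closedLoop k y⟫_ℝ) x :=
              (continuous_gradient hh.contDiff).continuousAt.inner (hF x h)
            exact (h2.eventually (lt_mem_nhds h1)).mono fun y hy _ => hy
        · filter_upwards [hh.contDiff.continuous.continuousAt.eventually (lt_mem_nhds hx0)]
            with y hy hneg
          exact absurd hneg (not_lt.2 hy.le)
      lipschitz := fun x hx => closedLoop_lipschitz hf hg (hksm x hx) }
  exact hcert.isSafeStabilized

end

/-! ### Worst-case errors. -/

lemma SOCC.ofNorm_holdsStrictly_iff {n m : ℕ} {a : Vec n → ℝ} {b : Vec n → Vec m}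
    {c : Vec n → ℝ} {x : Vec n} (ha : 0 ≤ a x) (u : Vec m) :
    (SOCC.ofNorm a b c).HoldsStrictly x u ↔ a x * ‖u‖ < ⟪b x, u⟫_ℝ + c x := by
  have h1 : Matrix.toEuclideanLin ((SOCC.ofNorm a b c).Q x) u
      = a x • WithLp.toLp 2 (Fin.snoc (fun j => u j) 0 : Fin (m + 1) → ℝ) := by
    ext i
    simp only [SOCC.ofNorm, Matrix.toLpLin_apply, Matrix.smul_mulVec, PiLp.smul_apply,
      Pi.smul_apply, smul_eq_mul]
    congr 1
    simp only [Matrix.mulVec, dotProduct, Matrix.of_apply]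
    refine Fin.lastCases ?_ (fun j => ?_) i
    · simp [(Fin.castSucc_ne_last _).symm]
    · simp [Fin.castSucc_inj]
  have h2 : ‖(WithLp.toLp 2 (Fin.snoc (fun j => u j) 0 : Fin (m + 1) → ℝ) : Vec (m + 1))‖
      = ‖u‖ := by
    rw [EuclideanSpace.norm_eq, EuclideanSpace.norm_eq, Fin.sum_univ_castSucc]
    simp
  have h3 : ‖Matrix.toEuclideanLin ((SOCC.ofNorm a b c).Q x) u + (SOCC.ofNorm a b c).r x‖
      = a x * ‖u‖ := by
    rw [h1]
    simp only [SOCC.ofNorm, add_zero]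
    rw [norm_smul, h2, Real.norm_of_nonneg ha]
  rw [SOCC.HoldsStrictly, h3]
  rfl

section

variable {n m : ℕ} {sys : ControlSystem n m} {C : Set (Vec n)} {V W S h B : Vec n → ℝ}
  {η : ℝ} {α ζ : ℝ → ℝ} {est : Estimates n m} {e : ErrorBounds n}

lemma norm_dynamics_error_le (he : e.Valid sys h est C) {x : Vec n} (hx : x ∈ C) {u : Vec m}
    {M : ℝ} (hu : ‖u‖ ≤ M) :
    ‖(sys.f x + sys.g x u) - (est.f x + est.g x u)‖ ≤ e.ef x + e.eg x * M := by
  have h1 : (sys.f x + sys.g x u) - (est.f x + est.g x u)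
      = (sys.f x - est.f x) + (sys.g x - est.g x) u := by
    rw [sub_apply]; abel
  have h2 : 0 ≤ e.eg x := (norm_nonneg _).trans (he.g_le x hx)
  rw [h1]
  refine (norm_add_le _ _).trans (add_le_add (he.f_le x hx) ?_)
  refine (ContinuousLinearMap.le_opNorm _ _).trans ?_
  have := he.g_le x hx
  gcongr

/-- The error `‖∇V‖ (e_f + e_g B)` is paid twice, once in replacing the true dynamics by the nominal
ones and once as the margin in the constraint; hence the factor `1 / 2`. -/
lemma worstCaseSOCCV_holdsStrictly (he : e.Valid sys h est C) {x : Vec n} (hx : x ∈ C)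
    {u : Vec m} (hu : ‖u‖ ≤ B x) (hV : lieDeriv sys V x u + W x ≤ -S x)
    (hsmall : ‖∇ V x‖ * (e.ef x + e.eg x * B x) < 1 / 2 * S x) :
    (worstCaseSOCCV est e V W).HoldsStrictly x u := by
  have hg0 : 0 ≤ e.eg x := (norm_nonneg _).trans (he.g_le x hx)
  refine (SOCC.ofNorm_holdsStrictly_iff (mul_nonneg (norm_nonneg _) hg0) u).2 ?_
  have h1 := norm_dynamics_error_le he hx hu
  have h2 : ⟪∇ V x, est.f x + est.g x u⟫_ℝ - lieDeriv sys V x u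
      ≤ ‖∇ V x‖ * (e.ef x + e.eg x * B x) := by
    rw [lieDeriv_eq, ← inner_sub_right]
    refine (real_inner_le_norm _ _).trans ?_
    rw [norm_sub_rev]
    gcongr
  have h3 : ‖∇ V x‖ * e.eg x * ‖u‖ ≤ ‖∇ V x‖ * (e.eg x * B x) := by
    rw [mul_assoc]
    gcongr
  rw [inner_neg_left, ContinuousLinearMap.adjoint_inner_left]
  rw [inner_add_right] at h2
  nlinarith

/-- Again the error is paid twice. Both the gradient and the dynamics are estimated, which produces
the three inner products in `h4`. -/
lemma worstCaseSOCCh_holdsStrictly (he : e.Valid sys h est C) {Kα : NNReal}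
    (hα : LipschitzWith Kα α) (hmono : Monotone α) {x : Vec n} (hx : x ∈ C)
    {u : Vec m} (hu : ‖u‖ ≤ B x)
    (hh : η + ζ (h x) ≤ lieDeriv sys h x u + α (h x))
    (hsmall : (e.edh x + ‖est.dh x‖) * (e.ef x + e.eg x * B x) + Kα * e.eh x
      + e.edh x * (‖est.f x‖ + ‖est.g x‖ * B x) < 1 / 2 * (η + ζ (h x))) :
    (worstCaseSOCCh est e α).HoldsStrictly x u := by
  have hg0 : 0 ≤ e.eg x := (norm_nonneg _).trans (he.g_le x hx)
  have hf0 : 0 ≤ e.ef x := (norm_nonneg _).trans (he.f_le x hx)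
  have hd0 : 0 ≤ e.edh x := (norm_nonneg _).trans (he.dh_le x hx)
  have hB : 0 ≤ B x := (norm_nonneg _).trans hu
  refine (SOCC.ofNorm_holdsStrictly_iff (by positivity) u).2 ?_
  set v := sys.f x + sys.g x u with hv
  set w := est.f x + est.g x u with hw
  have h1 : ‖v - w‖ ≤ e.ef x + e.eg x * B x := norm_dynamics_error_le he hx hu
  have h2 : ‖w‖ ≤ ‖est.f x‖ + ‖est.g x‖ * B x := by
    refine (norm_add_le _ _).trans (add_le_add le_rfl ?_)
    exact (ContinuousLinearMap.le_opNorm _ _).trans (by gcongr)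
  have h3 : lieDeriv sys h x u - ⟪est.dh x, w⟫_ℝ
      ≤ (e.edh x + ‖est.dh x‖) * (e.ef x + e.eg x * B x)
        + e.edh x * (‖est.f x‖ + ‖est.g x‖ * B x) := by
    have h4 : lieDeriv sys h x u - ⟪est.dh x, w⟫_ℝ
        = ⟪∇ h x - est.dh x, v - w⟫_ℝ + ⟪est.dh x, v - w⟫_ℝ + ⟪∇ h x - est.dh x, w⟫_ℝ := by
      rw [lieDeriv_eq, ← hv]
      simp only [inner_sub_left, inner_sub_right]
      ring
    have hd := he.dh_le x hx
    rw [h4, add_mul]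
    refine add_le_add (add_le_add ?_ ?_) ?_ <;> refine (real_inner_le_norm _ _).trans ?_ <;>
      gcongr
  -- `est.h x - e.eh x ≥ h x - 2 * e.eh x`, so monotonicity and the Lipschitz bound cost `Kα * e.eh
  -- x` twice.
  have h5 : α (h x) - 2 * (Kα * e.eh x) ≤ α (est.h x - e.eh x) := by
    have hab := abs_le.1 (he.h_le x hx)
    have h6 := hα.dist_le_mul (h x) (h x - 2 * e.eh x)
    have h7 : α (h x - 2 * e.eh x) ≤ α (est.h x - e.eh x) := hmono (by linarith)
    have h8 : 0 ≤ e.eh x := (abs_nonneg _).trans (he.h_le x hx)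
    have h9 : dist (h x) (h x - 2 * e.eh x) = 2 * e.eh x := by
      rw [Real.dist_eq, sub_sub_cancel, abs_of_nonneg (by linarith)]
    rw [h9, Real.dist_eq] at h6
    linarith [(abs_le.1 h6).2]
  have h6 : (e.edh x * e.eg x + e.edh x * ‖est.g x‖ + ‖est.dh x‖ * e.eg x) * ‖u‖
      ≤ (e.edh x * e.eg x + e.edh x * ‖est.g x‖ + ‖est.dh x‖ * e.eg x) * B x := by gcongr
  rw [ContinuousLinearMap.adjoint_inner_left]
  rw [hw, inner_add_right] at h3
  nlinarith

/-- The values at which two constraints hold strictly, provided that their data are continuous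
on the safe set away from the origin. -/
def strictSet {n m : ℕ} (q₁ q₂ : SOCC n m) (s : Set (Vec n)) (x : Vec n) : Set (Vec m) :=
  {u | q₁.ContOn s → q₂.ContOn s → q₁.HoldsStrictly x u ∧ q₂.HoldsStrictly x u}

lemma convex_strictSet {n m : ℕ} (q₁ q₂ : SOCC n m) (s : Set (Vec n)) (x : Vec n) :
    Convex ℝ (strictSet q₁ q₂ s x) := fun _ hu _ hv _ _ ha hb hab h₁ h₂ =>
  ⟨q₁.convex_holdsStrictly x (hu h₁ h₂).1 (hv h₁ h₂).1 ha hb hab,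
    q₂.convex_holdsStrictly x (hu h₁ h₂).2 (hv h₁ h₂).2 ha hb hab⟩

/-- If the controls provided by the compatibility of the slacks satisfy two constraints strictly,
then there is a safe stabilizing controller that satisfies them. -/
theorem exists_controller_of_holdsStrictly {Γ : Set (Vec n)}
    (hf : LocallyLipschitz sys.f) (hg : LocallyLipschitz sys.g)
    (hh : IsRobustCBF sys C h η α) (hV : IsCLF sys Γ V W) (hCΓ : C ⊆ Γ)
    (hS : IsPosDefFun S) (hζ : IsClassKInf ζ)
    (hcompat : SlackCompatible sys C V W S h η α ζ B)
    (hαcont : ContinuousOn (fun x => α (h x)) C) (q₁ q₂ : SOCC n m)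
    (hq : ∀ x ∈ C \ {0}, ∀ u : Vec m, lieDeriv sys V x u + W x ≤ -S x →
      η + ζ (h x) ≤ lieDeriv sys h x u + α (h x) → ‖u‖ ≤ B x →
      q₁.HoldsStrictly x u ∧ q₂.HoldsStrictly x u) :
    ∃ k : Vec n → Vec m, k 0 = 0 ∧ ContDiffOn ℝ (⊤ : ℕ∞) k {0}ᶜ ∧
      IsSafeStabilized (sys.closedLoop k) C ∧
      (q₁.ContOn (C \ {0}) → q₂.ContOn (C \ {0}) →
        ∀ x ∈ C \ {0}, q₁.Holds x (k x) ∧ q₂.Holds x (k x)) := by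
  obtain ⟨k, hk0, hksm, hks, hkR⟩ := exists_safe_stabilizing_controller hf hg hh hV hCΓ hS hζ
    hcompat hαcont (strictSet q₁ q₂ (C \ {0})) (convex_strictSet _ _ _) fun x hx u h1 h2 h3 => by
      -- Without continuity of the data `strictSet` is everything, so one controller serves both
      -- forms of the claim.
      by_cases hc : q₁.ContOn (C \ {0}) ∧ q₂.ContOn (C \ {0})
      · have hu := hq x hx u h1 h2 h3
        filter_upwards [hc.1.eventually_holdsStrictly hx hu.1,
          hc.2.eventually_holdsStrictly hx hu.2] with y hy1 hy2 _ _
        exact ⟨hy1, hy2⟩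
      · exact .of_forall fun y hc1 hc2 => absurd ⟨hc1, hc2⟩ hc
  exact ⟨k, hk0, fun x hx => (hksm x hx).contDiffWithinAt, hks, fun hc1 hc2 x hx =>
    ⟨(hkR x hx hc1 hc2).1.holds, (hkR x hx hc1 hc2).2.holds⟩⟩

end

/-! ### Singular values. -/

/-- The largest singular value bounds the operator norm. -/
lemma norm_apply_le_singularValues_zero {E F : Type*} [NormedAddCommGroup E]
    [InnerProductSpace ℝ E] [FiniteDimensional ℝ E] [NormedAddCommGroup F]
    [InnerProductSpace ℝ F] [FiniteDimensional ℝ F] (T : E →ₗ[ℝ] F) (v : E) :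
    ‖T v‖ ≤ T.singularValues 0 * ‖v‖ := by
  refine abs_le_of_sq_le_sq' ?_ (mul_nonneg (T.singularValues_nonneg 0) (norm_nonneg v)) |>.2
  -- `‖T v‖²` is the quadratic form of `T* T`; in an eigenbasis its coefficients are the squared
  -- singular values.
  have hs := T.isSymmetric_adjoint_comp_self
  set b := hs.eigenvectorBasis rfl
  have h1 : ‖T v‖ ^ 2 = ⟪v, (LinearMap.adjoint T ∘ₗ T) v⟫_ℝ := by
    rw [LinearMap.comp_apply, LinearMap.adjoint_inner_right, real_inner_self_eq_norm_sq]
  have h2 : ∀ i, ⟪b i, (LinearMap.adjoint T ∘ₗ T) v⟫_ℝ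
      = T.singularValues i ^ 2 * ⟪b i, v⟫_ℝ := by
    intro i
    have := hs.eigenvectorBasis_apply_self_apply rfl v i
    rw [OrthonormalBasis.repr_apply_apply, OrthonormalBasis.repr_apply_apply] at this
    rw [T.sq_singularValues_fin rfl]
    exact this
  rw [h1, ← b.sum_inner_mul_inner, mul_pow, ← b.sum_sq_norm_inner_right v, Finset.mul_sum]
  refine Finset.sum_le_sum fun i _ => ?_
  rw [h2 i, real_inner_comm, Real.norm_eq_abs, sq_abs]
  have h3 : T.singularValues i ≤ T.singularValues 0 := T.singularValues_antitone (Nat.zero_le _)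
  have h4 : T.singularValues i ^ 2 ≤ T.singularValues 0 ^ 2 :=
    pow_le_pow_left₀ (T.singularValues_nonneg i) h3 2
  nlinarith [mul_le_mul_of_nonneg_right h4 (sq_nonneg ⟪b i, v⟫_ℝ)]

/-! ### Spectral estimates for regularized Gram matrices. -/

section LinearAlgebra

variable {N : ℕ}

/-- The spectral theorem for positive semidefinite real matrices, in coordinates. -/
lemma exists_eigenbasis {K : Matrix (Fin N) (Fin N) ℝ} (hK : K.PosSemidef) :
    ∃ (v : Fin N → Fin N → ℝ) (l : Fin N → ℝ), (∀ j, 0 ≤ l j) ∧ (∀ j, K *ᵥ v j = l j • v j) ∧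
      (∀ j, v j ⬝ᵥ v j = 1) ∧ (∀ x y, x ⬝ᵥ y = ∑ j, (v j ⬝ᵥ x) * (v j ⬝ᵥ y)) ∧
      ∀ c : ℝ, c ≠ 0 → (1 + c • K).det = ∏ j, (1 + c * l j) := by
  set b := hK.1.eigenvectorBasis
  have hinner : ∀ x y : EuclideanSpace ℝ (Fin N), ⟪x, y⟫_ℝ = x.ofLp ⬝ᵥ y.ofLp := fun x y => by
    rw [EuclideanSpace.inner_eq_star_dotProduct, star_trivial, dotProduct_comm]
  refine ⟨fun j => (b j).ofLp, hK.1.eigenvalues, hK.eigenvalues_nonneg,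
    hK.1.mulVec_eigenvectorBasis, fun j => ?_, fun x y => ?_, fun c hc => ?_⟩
  · rw [← hinner, real_inner_self_eq_norm_sq, b.orthonormal.1 j, one_pow]
  · have := b.sum_inner_mul_inner (WithLp.toLp 2 x) (WithLp.toLp 2 y)
    simp only [hinner] at this
    rw [← this]
    exact Finset.sum_congr rfl fun j _ => by rw [dotProduct_comm x]
  -- Up to the factor `(-c) ^ N`, the determinant is the characteristic polynomial at `-c⁻¹`.
  · have h1 : (1 + c • K) = (-c) • (Matrix.scalar (Fin N) (-c⁻¹) - K) := by
      ext i j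
      by_cases hij : i = j
      · simp [Matrix.scalar_apply, hij, mul_sub, mul_inv_cancel₀ hc]
      · simp [Matrix.scalar_apply, hij]
    rw [h1, Matrix.det_smul, ← Matrix.eval_charpoly, hK.1.charpoly_eq, Polynomial.eval_prod,
      ← Finset.card_univ, ← Finset.prod_const, ← Finset.prod_mul_distrib]
    refine Finset.prod_congr rfl fun j _ => ?_
    simp only [Polynomial.eval_sub, Polynomial.eval_X, Polynomial.eval_C, RCLike.ofReal_real_eq_id,
      id_eq]
    field_simp
    ring

lemma posDef_add_smul_one {K : Matrix (Fin N) (Fin N) ℝ} (hK : K.PosSemidef) {s : ℝ}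
    (hs : 0 < s) : (K + s • (1 : Matrix (Fin N) (Fin N) ℝ)).PosDef :=
  Matrix.PosDef.posSemidef_add hK (Matrix.PosDef.one.smul hs)

lemma add_smul_one_mulVec_inv {K : Matrix (Fin N) (Fin N) ℝ} (hK : K.PosSemidef) {s : ℝ}
    (hs : 0 < s) (y : Fin N → ℝ) :
    K *ᵥ ((K + s • (1 : Matrix (Fin N) (Fin N) ℝ))⁻¹ *ᵥ y)
      + s • ((K + s • (1 : Matrix (Fin N) (Fin N) ℝ))⁻¹ *ᵥ y) = y := by
  set M := K + s • (1 : Matrix (Fin N) (Fin N) ℝ) with hM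
  have hdet : IsUnit M.det := (posDef_add_smul_one hK hs).det_pos.ne'.isUnit
  have h1 : M *ᵥ (M⁻¹ *ᵥ y) = y := by
    rw [Matrix.mulVec_mulVec, Matrix.mul_nonsing_inv _ hdet, Matrix.one_mulVec]
  conv_rhs => rw [← h1]
  conv_rhs => rw [hM]
  rw [Matrix.add_mulVec, Matrix.smul_mulVec, Matrix.one_mulVec]

lemma dotProduct_mulVec_comm {A : Matrix (Fin N) (Fin N) ℝ} (hA : A.IsHermitian)
    (x y : Fin N → ℝ) : x ⬝ᵥ A *ᵥ y = (A *ᵥ x) ⬝ᵥ y := by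
  rw [Matrix.dotProduct_mulVec, ← Matrix.mulVec_transpose]
  congr 2

/-- The quadratic form of `K (K + s)⁻¹` at a vector whose coordinates in an eigenbasis are at
most `t` is bounded by `t²` times `log det (1 + s⁻¹ K)`. -/
lemma quadForm_le_log_det {K : Matrix (Fin N) (Fin N) ℝ} (hK : K.PosSemidef) {s : ℝ}
    (hs : 0 < s) {v : Fin N → Fin N → ℝ} {l : Fin N → ℝ} (hl : ∀ j, 0 ≤ l j)
    (hv : ∀ j, K *ᵥ v j = l j • v j) (hpars : ∀ x y, x ⬝ᵥ y = ∑ j, (v j ⬝ᵥ x) * (v j ⬝ᵥ y))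
    (hdet : ∀ c : ℝ, c ≠ 0 → (1 + c • K).det = ∏ j, (1 + c * l j)) {t : ℝ} {y : Fin N → ℝ}
    (hy : ∀ j, |v j ⬝ᵥ y| ≤ t) :
    y ⬝ᵥ K *ᵥ ((K + s • (1 : Matrix (Fin N) (Fin N) ℝ))⁻¹ *ᵥ y)
      ≤ t ^ 2 * Real.log (1 + s⁻¹ • K).det := by
  set b := (K + s • (1 : Matrix (Fin N) (Fin N) ℝ))⁻¹ *ᵥ y with hb
  have hKb : ∀ j, v j ⬝ᵥ K *ᵥ b = l j * (v j ⬝ᵥ b) := fun j => by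
    rw [dotProduct_mulVec_comm hK.1, hv, smul_dotProduct, smul_eq_mul]
  have hyb : ∀ j, v j ⬝ᵥ y = (l j + s) * (v j ⬝ᵥ b) := fun j => by
    conv_lhs => rw [← add_smul_one_mulVec_inv hK hs y, ← hb]
    rw [dotProduct_add, hKb, dotProduct_smul, smul_eq_mul]
    ring
  have hpos : ∀ j, 0 < 1 + s⁻¹ * l j := fun j => by
    have := mul_nonneg (inv_nonneg.2 hs.le) (hl j)
    linarith
  rw [hpars, hdet _ (inv_ne_zero hs.ne'), Real.log_prod (fun j _ => (hpos j).ne'),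
    Finset.mul_sum]
  refine Finset.sum_le_sum fun j _ => ?_
  have hls : 0 < l j + s := add_pos_of_nonneg_of_pos (hl j) hs
  -- Along `v j` the form has weight `l j / (l j + s) = 1 - 1 / r` with `r = 1 + s⁻¹ * l j`, and
  -- this is at most `log r`.
  have h1 : (v j ⬝ᵥ y) * (v j ⬝ᵥ K *ᵥ b) = (v j ⬝ᵥ y) ^ 2 * (1 - (1 + s⁻¹ * l j)⁻¹) := by
    have h2 : 1 + s⁻¹ * l j = (l j + s) / s := by field_simp; ring
    rw [hKb, hyb, h2, inv_div]
    field_simp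
    ring
  rw [h1]
  have h2 : (v j ⬝ᵥ y) ^ 2 ≤ t ^ 2 := sq_le_sq' (by linarith [(abs_le.1 (hy j)).1])
    (abs_le.1 (hy j)).2
  have h3 := Real.one_sub_inv_le_log_of_pos (hpos j)
  have h4 : 0 ≤ 1 - (1 + s⁻¹ * l j)⁻¹ := sub_nonneg.2 (inv_le_one_of_one_le₀ (by
    have := mul_nonneg (inv_nonneg.2 hs.le) (hl j)
    linarith))
  exact mul_le_mul h2 h3 h4 (sq_nonneg t)

end LinearAlgebra

/-! ### Ridge regression in a Hilbert space. -/

section HilbertRegression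

variable {N : ℕ} {H : Type*} [NormedAddCommGroup H] [InnerProductSpace ℝ H]
  (w : Fin N → H) (φ : H)

lemma inner_sum_smul_gram (a b : Fin N → ℝ) :
    ⟪∑ i, a i • w i, ∑ i, b i • w i⟫_ℝ = a ⬝ᵥ Matrix.gram ℝ w *ᵥ b := by
  simp only [sum_inner, inner_sum, inner_smul_left, inner_smul_right, dotProduct, Matrix.mulVec,
    Matrix.gram_apply, Finset.mul_sum]
  rw [Finset.sum_comm]
  refine Finset.sum_congr rfl fun i _ => Finset.sum_congr rfl fun j _ => ?_
  rw [conj_trivial]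
  ring

lemma inner_sum_smul (a : Fin N → ℝ) (f : H) :
    ⟪∑ i, a i • w i, f⟫_ℝ = a ⬝ᵥ fun i => ⟪w i, f⟫_ℝ := by
  simp [sum_inner, inner_smul_left, dotProduct]

/-- The posterior variance as a sum of squares. -/
lemma posterior_variance_eq {s : ℝ} (hs : 0 < s) {κ a : Fin N → ℝ}
    (hκ : κ = fun i => ⟪w i, φ⟫_ℝ)
    (ha : a = (Matrix.gram ℝ w + s • (1 : Matrix (Fin N) (Fin N) ℝ))⁻¹ *ᵥ κ) :
    ⟪φ, φ⟫_ℝ - κ ⬝ᵥ a = ‖φ - ∑ i, a i • w i‖ ^ 2 + s * (a ⬝ᵥ a) := by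
  -- The normal equations `K a + s a = κ` of the regression of `φ` on the `w i`.
  have h1 := add_smul_one_mulVec_inv (Matrix.posSemidef_gram ℝ w) hs κ
  rw [← ha] at h1
  have h2 : a ⬝ᵥ Matrix.gram ℝ w *ᵥ a = κ ⬝ᵥ a - s * (a ⬝ᵥ a) := by
    conv_rhs => rw [← h1]
    rw [add_dotProduct, smul_dotProduct, smul_eq_mul, dotProduct_comm a]
    ring
  rw [← real_inner_self_eq_norm_sq, inner_sub_left, inner_sub_right, inner_sub_right,
    inner_sum_smul_gram, h2, real_inner_comm (∑ i, a i • w i) φ, inner_sum_smul, ← hκ,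
    dotProduct_comm a κ]
  ring

/-- The effect of the measurement noise `y` on the posterior mean is bounded by the posterior
standard deviation times a quadratic form in `y`. -/
lemma posterior_noise_sq_le {s : ℝ} (hs : 0 < s) {κ a : Fin N → ℝ}
    (hκ : κ = fun i => ⟪w i, φ⟫_ℝ)
    (ha : a = (Matrix.gram ℝ w + s • (1 : Matrix (Fin N) (Fin N) ℝ))⁻¹ *ᵥ κ)
    (y : Fin N → ℝ) :
    (a ⬝ᵥ y) ^ 2 ≤ (⟪φ, φ⟫_ℝ - κ ⬝ᵥ a) * ((y ⬝ᵥ Matrix.gram ℝ w *ᵥ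
      ((Matrix.gram ℝ w + s • (1 : Matrix (Fin N) (Fin N) ℝ))⁻¹ *ᵥ y)) / s) := by
  have hK := Matrix.posSemidef_gram ℝ w
  set K := Matrix.gram ℝ w with hKdef
  rw [posterior_variance_eq w φ hs hκ ha]
  set b := (K + s • (1 : Matrix (Fin N) (Fin N) ℝ))⁻¹ *ᵥ y with hb
  have h1 := add_smul_one_mulVec_inv hK hs κ
  rw [← ha] at h1
  have h2 := add_smul_one_mulVec_inv hK hs y
  rw [← hb] at h2
  -- Cauchy–Schwarz in `H × ℝᴺ`: `a ⬝ᵥ y` is the inner product of `(r, √s a)` and `(p, q / √s)`,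
  -- whose squared norms are the two factors on the right.
  set r := φ - ∑ i, a i • w i with hr
  set p := ∑ i, b i • w i with hp
  set q := K *ᵥ b with hq
  have hrp : ⟪r, p⟫_ℝ = s * (a ⬝ᵥ b) := by
    rw [real_inner_comm, hr, hp, inner_sub_right, inner_sum_smul_gram, inner_sum_smul, ← hκ,
      ← dotProduct_sub, ← h1, ← hKdef, add_sub_cancel_left, dotProduct_smul, smul_eq_mul,
      dotProduct_comm]
  have hay : a ⬝ᵥ y = ⟪r, p⟫_ℝ + a ⬝ᵥ q := by
    conv_lhs => rw [← h2]
    rw [dotProduct_add, dotProduct_smul, smul_eq_mul, hrp]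
    ring
  have hpp : ‖p‖ ^ 2 = b ⬝ᵥ q := by
    rw [← real_inner_self_eq_norm_sq, hp, inner_sum_smul_gram]
  have hyq : y ⬝ᵥ q = q ⬝ᵥ q + s * ‖p‖ ^ 2 := by
    conv_lhs => rw [← h2]
    rw [add_dotProduct, smul_dotProduct, smul_eq_mul, hpp]
  have hcs1 : ⟪r, p⟫_ℝ ^ 2 ≤ ‖r‖ ^ 2 * ‖p‖ ^ 2 := by
    rw [← mul_pow]
    exact sq_le_sq' (by linarith [(abs_le.1 (abs_real_inner_le_norm r p)).1])
      (real_inner_le_norm r p)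
  have hcs2 : (a ⬝ᵥ q) ^ 2 ≤ (a ⬝ᵥ a) * (q ⬝ᵥ q) := by
    have := Finset.sum_mul_sq_le_sq_mul_sq Finset.univ a q
    simpa only [dotProduct, pow_two] using this
  have ha0 : 0 ≤ a ⬝ᵥ a := Finset.sum_nonneg fun i _ => mul_self_nonneg _
  have hq0 : 0 ≤ q ⬝ᵥ q := Finset.sum_nonneg fun i _ => mul_self_nonneg _
  rw [hay, hyq, ← mul_div_assoc, le_div_iff₀ hs]
  have hcross : 2 * s * (⟪r, p⟫_ℝ * (a ⬝ᵥ q))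
      ≤ ‖r‖ ^ 2 * (q ⬝ᵥ q) + s ^ 2 * ((a ⬝ᵥ a) * ‖p‖ ^ 2) := by
    refine (abs_le_of_sq_le_sq' ?_ (by positivity)).2
    have h3 := mul_le_mul hcs1 hcs2 (sq_nonneg _) (by positivity)
    have h4 := mul_le_mul_of_nonneg_left h3 (by positivity : 0 ≤ 4 * s ^ 2)
    nlinarith [sq_nonneg (‖r‖ ^ 2 * (q ⬝ᵥ q) - s ^ 2 * ((a ⬝ᵥ a) * ‖p‖ ^ 2))]
  nlinarith [mul_le_mul_of_nonneg_left hcs1 hs.le, mul_le_mul_of_nonneg_left hcs2 hs.le]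

end HilbertRegression

/-! ### Concentration of the noise. -/

/-- Hoeffding's inequality for normalized linear combinations of bounded noise. -/
lemma measure_lt_abs_dotProduct_le {Ω : Type*} [MeasurableSpace Ω] {P : Measure Ω}
    [IsProbabilityMeasure P] {N : ℕ} {X : Fin N → Ω → ℝ} {σ : ℝ} (hσ : 0 < σ)
    (hm : ∀ i, Measurable (X i)) (hind : ProbabilityTheory.iIndepFun X P)
    (hmean : ∀ i, ∫ ω, X i ω ∂P = 0) (hbd : ∀ i, ∀ᵐ ω ∂P, |X i ω| ≤ σ)
    {v : Fin N → ℝ} (hv : v ⬝ᵥ v = 1) {t : ℝ} (ht : 0 ≤ t) :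
    P {ω | t < |v ⬝ᵥ fun i => X i ω|} ≤ ENNReal.ofReal (2 * Real.exp (-t ^ 2 / (2 * σ ^ 2))) := by
  have hsub : ∀ i, ProbabilityTheory.HasSubgaussianMGF (X i) (⟨σ ^ 2, sq_nonneg σ⟩ : NNReal) P := by
    intro i
    have h1 := ProbabilityTheory.hasSubgaussianMGF_of_mem_Icc_of_integral_eq_zero
      (hm i).aemeasurable (a := -σ) (b := σ) ((hbd i).mono fun ω hω => abs_le.1 hω) (hmean i)
    have h2 : ((‖σ - -σ‖₊ / 2) ^ 2 : NNReal) = (⟨σ ^ 2, sq_nonneg σ⟩ : NNReal) := by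
      apply NNReal.coe_injective
      push_cast
      rw [Real.norm_of_nonneg (by linarith)]
      change _ = σ ^ 2
      ring
    rwa [h2] at h1
  have key : ∀ u : Fin N → ℝ, u ⬝ᵥ u = 1 →
      P.real {ω | t ≤ u ⬝ᵥ fun i => X i ω} ≤ Real.exp (-t ^ 2 / (2 * σ ^ 2)) := by
    intro u hu
    have h1 := ProbabilityTheory.HasSubgaussianMGF.sum_of_iIndepFun (s := Finset.univ)
      (hind.comp (fun i => (fun r => u i * r)) fun i => measurable_const_mul (u i))
      (fun i _ => (hsub i).const_mul (u i))
    have h2 := h1.measure_ge_le ht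
    refine h2.trans_eq ?_
    congr 3
    rw [NNReal.coe_sum]
    calc _ = ∑ i, u i * u i * σ ^ 2 := Finset.sum_congr rfl fun i _ => by
          change u i ^ 2 * σ ^ 2 = _
          ring
      _ = (u ⬝ᵥ u) * σ ^ 2 := by rw [← Finset.sum_mul]; rfl
      _ = σ ^ 2 := by rw [hu, one_mul]
  have hcover : {ω | t < |v ⬝ᵥ fun i => X i ω|} ⊆
      {ω | t ≤ v ⬝ᵥ fun i => X i ω} ∪ {ω | t ≤ (-v) ⬝ᵥ fun i => X i ω} := by
    intro ω hω
    rcases lt_abs.1 (show t < |v ⬝ᵥ fun i => X i ω| from hω) with h | h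
    · exact .inl h.le
    · refine .inr ?_
      change t ≤ (-v) ⬝ᵥ fun i => X i ω
      rw [neg_dotProduct]
      exact h.le
  have h1 := (measureReal_mono (μ := P) hcover).trans (measureReal_union_le _ _)
  have h2 := key v hv
  have h3 := key (-v) (by rw [neg_dotProduct_neg, hv])
  rw [← ofReal_measureReal]
  exact ENNReal.ofReal_le_ofReal (by linarith)

/-! ### Confidence bounds for Gaussian process regression. -/

section GP

variable {Z : Type*} {H : Type*} [NormedAddCommGroup H] [InnerProductSpace ℝ H] [CompleteSpace H]
  [RKHS ℝ H Z ℝ]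

/-- Turns kernel expressions into inner products of feature vectors, so that the ridge regression
results apply. -/
lemma kern_eq_inner (z z' : Z) :
    kern H z z' = ⟪RKHS.kerFun H z (1 : ℝ), RKHS.kerFun H z' (1 : ℝ)⟫_ℝ := by
  have := RKHS.kernel_inner H z z' (1 : ℝ) (1 : ℝ)
  rw [real_inner_comm, ← this]
  simp [kern]

lemma gram_eq {N : ℕ} (p : Fin N → Z) :
    gram H p = Matrix.gram ℝ fun i => RKHS.kerFun H (p i) (1 : ℝ) := by
  ext i j
  rw [Matrix.gram_apply, gram, Matrix.of_apply, kern_eq_inner]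

lemma posSemidef_gram {N : ℕ} (p : Fin N → Z) : (gram H p).PosSemidef := by
  rw [gram_eq]
  exact Matrix.posSemidef_gram ℝ _

lemma one_le_det_one_add_smul_gram {N : ℕ} (p : Fin N → Z) {c : ℝ} (hc : 0 < c) :
    1 ≤ (1 + c • gram H p).det := by
  obtain ⟨v, l, hl, -, -, -, hdet⟩ := exists_eigenbasis (posSemidef_gram (H := H) p)
  rw [hdet c hc.ne']
  calc (1 : ℝ) = ∏ _j : Fin N, 1 := by simp
    _ ≤ _ := Finset.prod_le_prod (fun _ _ => zero_le_one) fun j _ =>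
      le_add_of_nonneg_right (mul_nonneg hc.le (hl j))

/-- The posterior variance is nonnegative. -/
lemma posterior_variance_nonneg {N : ℕ} (p : Fin N → Z) (z : Z) {s : ℝ} (hs : 0 < s) :
    0 ≤ kern H z z - (fun i => kern H (p i) z) ⬝ᵥ
      (gram H p + s • (1 : Matrix (Fin N) (Fin N) ℝ))⁻¹ *ᵥ fun i => kern H (p i) z := by
  rw [gram_eq, kern_eq_inner, posterior_variance_eq (fun i => RKHS.kerFun H (p i) (1 : ℝ))
    (RKHS.kerFun H z (1 : ℝ)) hs (funext fun i => kern_eq_inner (p i) z) rfl]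
  exact add_nonneg (sq_nonneg _) (mul_nonneg hs.le
    (Finset.sum_nonneg fun i _ => mul_self_nonneg _))

/-- An additional sample does not decrease the determinant. -/
lemma det_le_det_append {N : ℕ} (p : Fin N → Z) (z : Z) {s : ℝ} (hs : 0 < s) :
    (1 + s⁻¹ • gram H p).det ≤ (1 + s⁻¹ • gram H (Fin.append p ![z])).det := by
  set K := gram H p with hK
  set κ : Fin N → ℝ := fun i => kern H (p i) z with hκ
  set M := 1 + s⁻¹ • K with hM
  have hdet1 : 1 ≤ M.det := one_le_det_one_add_smul_gram p (inv_pos.2 hs)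
  have hMdet : IsUnit M.det := (by linarith : (0 : ℝ) < M.det).ne'.isUnit
  have hblock : (1 + s⁻¹ • gram H (Fin.append p ![z])).submatrix finSumFinEquiv finSumFinEquiv
      = Matrix.fromBlocks M (Matrix.of fun i (_ : Fin 1) => s⁻¹ * κ i)
        (Matrix.of fun (_ : Fin 1) j => s⁻¹ * κ j)
        (Matrix.of fun (_ _ : Fin 1) => 1 + s⁻¹ * kern H z z) := by
    have hsymm : ∀ a b : Z, kern H a b = kern H b a := fun a b => by
      rw [kern_eq_inner, kern_eq_inner, real_inner_comm]
    have hne : ∀ (i : Fin N) (j : Fin 1), Fin.castAdd 1 i ≠ Fin.natAdd N j := fun i j h => by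
      have := congrArg Fin.val h
      simp only [Fin.val_castAdd, Fin.val_natAdd] at this
      omega
    ext i j
    rcases i with i | i <;> rcases j with j | j
    · simp [hM, hK, gram, Matrix.one_apply]
    · simp [hκ, gram, Matrix.one_apply_ne (hne i j)]
    · simp [hκ, gram, Matrix.one_apply_ne (hne j i).symm, hsymm z]
    · simp [gram, Subsingleton.elim i j]
  rw [← Matrix.det_submatrix_equiv_self finSumFinEquiv
    (1 + s⁻¹ • gram H (Fin.append p ![z])), hblock]
  let _ := M.invertibleOfIsUnitDet hMdet
  rw [Matrix.det_fromBlocks₁₁, Matrix.invOf_eq_nonsing_inv]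
  refine le_mul_of_one_le_right (by linarith) ?_
  -- With this inverse the Schur complement is `1` plus `s⁻¹` times the posterior variance at `z`,
  -- hence at least `1`.
  have hinv : M⁻¹ = s • (K + s • (1 : Matrix (Fin N) (Fin N) ℝ))⁻¹ := by
    have h1 : K + s • (1 : Matrix (Fin N) (Fin N) ℝ) = s • M := by
      rw [hM, smul_add, smul_smul, mul_inv_cancel₀ hs.ne', one_smul, add_comm]
    have h2 : IsUnit (K + s • (1 : Matrix (Fin N) (Fin N) ℝ)).det :=
      (posDef_add_smul_one (posSemidef_gram p) hs).det_pos.ne'.isUnit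
    refine Matrix.inv_eq_right_inv ?_
    rw [Matrix.mul_smul, ← Matrix.smul_mul, ← h1, Matrix.mul_nonsing_inv _ h2]
  have hvar := posterior_variance_nonneg (H := H) p z hs
  rw [← hκ, ← hK] at hvar
  have hval : (Matrix.of (fun (_ : Fin 1) j => s⁻¹ * κ j) * M⁻¹ *
      Matrix.of fun i (_ : Fin 1) => s⁻¹ * κ i) 0 0
      = s⁻¹ * (κ ⬝ᵥ (K + s • (1 : Matrix (Fin N) (Fin N) ℝ))⁻¹ *ᵥ κ) := by
    rw [hinv, Matrix.mul_assoc]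
    simp only [Matrix.mul_apply, Matrix.of_apply, Matrix.smul_apply, smul_eq_mul, dotProduct,
      Matrix.mulVec, Finset.mul_sum]
    refine Finset.sum_congr rfl fun i _ => Finset.sum_congr rfl fun j _ => ?_
    field_simp
  rw [Matrix.det_fin_one, Matrix.sub_apply, hval, Matrix.of_apply]
  have := mul_nonneg (inv_nonneg.2 hs.le) hvar
  linarith

namespace GPRegression

variable {Ω : Type*} [MeasurableSpace Ω] {P : Measure Ω} {A : Set Z} {Δ : Z → ℝ}
  (M : GPRegression H P A Δ)

lemma infoGain_nonneg {σ : ℝ} (hσ : 0 < σ) {N : ℕ} (p : Fin N → Z) : 0 ≤ infoGain H σ p :=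
  mul_nonneg (by norm_num) (Real.log_nonneg
    (one_le_det_one_add_smul_gram p (inv_pos.2 (pow_pos hσ 2))))

lemma sSup_infoGains_nonneg : 0 ≤ sSup (infoGains H M.σ M.D (M.N + 1)) :=
  Real.sSup_nonneg fun _ ⟨p, _, hp⟩ => hp ▸ infoGain_nonneg M.σ_pos p

/-- The information gain of the samples is at most the maximum information gain from one sample
more. -/
lemma log_det_le_sSup_infoGains (hN : 0 < M.N) :
    Real.log (1 + (M.σ ^ 2)⁻¹ • gram H M.pt).det
      ≤ 2 * sSup (infoGains H M.σ M.D (M.N + 1)) := by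
  -- The additional sample repeats the first point, so it lies in `D`; this needs `0 < N`.
  have h1 : infoGain H M.σ (Fin.append M.pt ![M.pt ⟨0, hN⟩])
      ≤ sSup (infoGains H M.σ M.D (M.N + 1)) := by
    refine le_csSup M.bddAbove_gain ⟨_, fun i => ?_, rfl⟩
    refine Fin.addCases (fun i => ?_) (fun i => ?_) i
    · rw [Fin.append_left]
      exact M.pt_mem i
    · rw [Fin.append_right]
      simpa using M.pt_mem ⟨0, hN⟩
  have hs := pow_pos M.σ_pos 2
  have hdet := one_le_det_one_add_smul_gram (H := H) M.pt (inv_pos.2 hs)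
  have h2 := Real.log_le_log (zero_lt_one.trans_le hdet) (det_le_det_append M.pt (M.pt ⟨0, hN⟩) hs)
  unfold infoGain at h1
  linarith

/-- Error of the posterior mean, in terms of a quadratic form of the noise. -/
lemma abs_sub_mean_le {z : Z} (hz : z ∈ A) (ω : Ω) :
    |Δ z - M.mean (M.obs ω) z| ≤ √(2 * M.bound ^ 2 + 2 * (((fun i => M.noise i ω) ⬝ᵥ
      gram H M.pt *ᵥ (M.regInv *ᵥ fun i => M.noise i ω)) / M.σ ^ 2)) * M.std z := by
  have hs := pow_pos M.σ_pos 2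
  set ε : Fin M.N → ℝ := fun i => M.noise i ω with hε
  set φ := RKHS.kerFun H z (1 : ℝ) with hφ
  set w : Fin M.N → H := fun i => RKHS.kerFun H (M.pt i) (1 : ℝ) with hw
  set κ := M.kvec z with hκdef
  have hκ : κ = fun i => ⟪w i, φ⟫_ℝ := funext fun i => kern_eq_inner (M.pt i) z
  set a := M.regInv *ᵥ κ with ha
  have ha' : a = (Matrix.gram ℝ w + M.σ ^ 2 • (1 : Matrix (Fin M.N) (Fin M.N) ℝ))⁻¹ *ᵥ κ := by
    rw [ha, regInv, gram_eq]
  have hvar : M.var z = ⟪φ, φ⟫_ℝ - κ ⬝ᵥ a := by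
    rw [var, kern_eq_inner]
  have hvar' := hvar.trans (posterior_variance_eq w φ hs hκ ha')
  have hnoise := posterior_noise_sq_le w φ hs hκ ha' ε
  have hregInv : M.regInv.IsHermitian :=
    (posDef_add_smul_one (posSemidef_gram (H := H) M.pt) hs).isHermitian.inv
  have hev : ∀ z, M.target z = ⟪RKHS.kerFun H z (1 : ℝ), M.target⟫_ℝ := fun z => by simp
  have hmean : M.mean (M.obs ω) z = (a ⬝ᵥ fun i => ⟪w i, M.target⟫_ℝ) + a ⬝ᵥ ε := by
    rw [mean, dotProduct_mulVec_comm hregInv, ← dotProduct_add]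
    congr 1
    ext i
    simp only [obs, Pi.add_apply, hε, hw, ← hev]
    rw [M.target_eq (M.pt i) (.inr (M.pt_mem i))]
  -- By the reproducing property, the noise-free part of the error is the target paired with the
  -- regression residual.
  have herr : Δ z - M.mean (M.obs ω) z = ⟪M.target, φ - ∑ i, a i • w i⟫_ℝ - a ⬝ᵥ ε := by
    rw [hmean, ← M.target_eq z (.inl hz), hev, inner_sub_right,
      real_inner_comm (∑ i, a i • w i) M.target, inner_sum_smul, real_inner_comm M.target]
    ring
  have hv0 : 0 ≤ M.var z := by
    rw [hvar']
    exact add_nonneg (sq_nonneg _) (mul_nonneg hs.le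
      (Finset.sum_nonneg fun i _ => mul_self_nonneg _))
  rw [← gram_eq] at hnoise
  change _ ≤ _ * ((ε ⬝ᵥ gram H M.pt *ᵥ (M.regInv *ᵥ ε)) / M.σ ^ 2) at hnoise
  rw [← hvar] at hnoise
  set Q := (ε ⬝ᵥ gram H M.pt *ᵥ (M.regInv *ᵥ ε)) / M.σ ^ 2
  have htarget : ⟪M.target, φ - ∑ i, a i • w i⟫_ℝ ^ 2 ≤ M.bound ^ 2 * M.var z := by
    have h1 : ⟪M.target, φ - ∑ i, a i • w i⟫_ℝ ^ 2
        ≤ ‖M.target‖ ^ 2 * ‖φ - ∑ i, a i • w i‖ ^ 2 := by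
      rw [← mul_pow]
      exact sq_le_sq' (by linarith [(abs_le.1 (abs_real_inner_le_norm M.target
        (φ - ∑ i, a i • w i))).1]) (real_inner_le_norm _ _)
    refine h1.trans (mul_le_mul (pow_le_pow_left₀ (norm_nonneg _) M.target_norm 2) ?_
      (sq_nonneg _) (sq_nonneg _))
    rw [hvar']
    exact le_add_of_nonneg_right (mul_nonneg hs.le
      (Finset.sum_nonneg fun i _ => mul_self_nonneg _))
  rw [std, ← Real.sqrt_mul' _ hv0]
  refine Real.abs_le_sqrt ?_
  rw [herr]
  -- `(x - y)² ≤ 2 x² + 2 y²`, the origin of the factors `2` under the root.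
  nlinarith [sq_nonneg (⟪M.target, φ - ∑ i, a i • w i⟫_ℝ + a ⬝ᵥ ε)]

/-- With probability at least `1 - δ`, the target is within `β` posterior standard deviations of
the posterior mean. -/
theorem exists_confidence_event [IsProbabilityMeasure P] {δ : ℝ} (hδ : 0 < δ) (hδ1 : δ < 1) :
    ∃ E : Set Ω, MeasurableSet E ∧ P Eᶜ ≤ ENNReal.ofReal δ ∧
      ∀ ω ∈ E, ∀ z ∈ A, |Δ z - M.mean (M.obs ω) z| ≤ M.beta δ * M.std z := by
  have hs := pow_pos M.σ_pos 2
  have hstd : ∀ z, 0 ≤ M.std z := fun z => Real.sqrt_nonneg _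
  have hgain := M.sSup_infoGains_nonneg
  obtain ⟨v, l, hl, hv, hv1, hpars, hdet⟩ := exists_eigenbasis (posSemidef_gram (H := H) M.pt)
  rcases Nat.eq_zero_or_pos M.N with hN | hN
  -- Without measurements there is no noise, and the bound holds surely.
  · refine ⟨univ, .univ, by simp, fun ω _ z hz => ?_⟩
    refine (M.abs_sub_mean_le hz ω).trans (mul_le_mul_of_nonneg_right ?_ (hstd z))
    refine Real.sqrt_le_sqrt (add_le_add le_rfl ?_)
    have : IsEmpty (Fin M.N) := by rw [hN]; infer_instance
    rw [dotProduct, Finset.univ_eq_empty, Finset.sum_empty, zero_div, mul_zero]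
    have hL : 0 ≤ Real.log ((M.N + 1 : ℝ) / δ) :=
      Real.log_nonneg ((one_le_div hδ).2 (by rw [hN]; push_cast; linarith))
    positivity
  have hNr : (1 : ℝ) ≤ M.N := by exact_mod_cast hN
  set L := Real.log ((M.N + 1 : ℝ) / δ) with hLdef
  have hL2 : Real.log 2 ≤ L := by
    refine Real.log_le_log two_pos ((le_div_iff₀ hδ).2 ?_)
    nlinarith
  have hLpos : (1 / 2 : ℝ) < L := by linarith [Real.log_two_gt_d9]
  -- With `t² = 2 σ² ℓ` each of the `N` eigendirections fails with probability at most `2 exp (-ℓ) =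
  -- δ / N`.
  set ℓ := Real.log (2 * M.N / δ) with hℓdef
  have hℓ0 : 0 ≤ ℓ := Real.log_nonneg ((one_le_div hδ).2 (by linarith))
  have hℓL : ℓ ≤ 2 * L := by
    have h1 : ℓ ≤ Real.log 2 + L := by
      rw [← Real.log_mul two_ne_zero (by positivity)]
      refine Real.log_le_log (by positivity) ?_
      rw [mul_div_assoc]
      gcongr
      linarith
    linarith
  set t := √(2 * M.σ ^ 2 * ℓ) with ht
  have ht2 : t ^ 2 = 2 * M.σ ^ 2 * ℓ := Real.sq_sqrt (by positivity)
  have hmeas : ∀ j, Measurable fun ω => v j ⬝ᵥ fun i => M.noise i ω := fun j => by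
    unfold dotProduct
    exact Finset.measurable_sum _ fun i _ => (M.noise_measurable i).const_mul _
  refine ⟨{ω | ∀ j, |v j ⬝ᵥ fun i => M.noise i ω| ≤ t}, ?_, ?_, fun ω hω z hz => ?_⟩
  · simp only [ofPred_forall]
    exact .iInter fun j => measurableSet_le (hmeas j).abs measurable_const
  · have hcompl : {ω | ∀ j, |v j ⬝ᵥ fun i => M.noise i ω| ≤ t}ᶜ
        = ⋃ j, {ω | t < |v j ⬝ᵥ fun i => M.noise i ω|} := by
      ext ω
      simp
    have hexp : 2 * Real.exp (-t ^ 2 / (2 * M.σ ^ 2)) = δ / M.N := by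
      have h1 : -t ^ 2 / (2 * M.σ ^ 2) = -ℓ := by
        have := M.σ_pos.ne'
        rw [ht2]
        field_simp
      rw [h1, Real.exp_neg, Real.exp_log (by positivity)]
      field_simp
    rw [hcompl]
    refine (measure_iUnion_fintype_le P _).trans ?_
    have h1 : ∀ j, P {ω | t < |v j ⬝ᵥ fun i => M.noise i ω|} ≤ ENNReal.ofReal (δ / M.N) :=
      fun j => hexp ▸ measure_lt_abs_dotProduct_le M.σ_pos M.noise_measurable M.noise_indep
        M.noise_mean M.noise_bound (hv1 j) (Real.sqrt_nonneg _)
    refine (Finset.sum_le_sum fun j _ => h1 j).trans_eq ?_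
    rw [← ENNReal.ofReal_sum_of_nonneg fun _ _ => by positivity, Finset.sum_const,
      Finset.card_fin, nsmul_eq_mul, mul_div_cancel₀ _ (by positivity)]
  · refine (M.abs_sub_mean_le hz ω).trans (mul_le_mul_of_nonneg_right ?_ (hstd z))
    refine Real.sqrt_le_sqrt (add_le_add le_rfl ?_)
    have hQ := quadForm_le_log_det (posSemidef_gram (H := H) M.pt) hs hl hv hpars hdet hω
    rw [ht2] at hQ
    have h1 : 2 * (((fun i => M.noise i ω) ⬝ᵥ
        gram H M.pt *ᵥ (M.regInv *ᵥ fun i => M.noise i ω)) / M.σ ^ 2)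
        ≤ 4 * ℓ * Real.log (1 + (M.σ ^ 2)⁻¹ • gram H M.pt).det := by
      rw [← mul_div_assoc, div_le_iff₀ hs]
      have : ((fun i => M.noise i ω) ⬝ᵥ
        gram H M.pt *ᵥ (M.regInv *ᵥ fun i => M.noise i ω)) ≤ _ := hQ
      linarith
    have h2 := M.log_det_le_sSup_infoGains hN
    set γ := sSup (infoGains H M.σ M.D (M.N + 1))
    calc _ ≤ 4 * ℓ * Real.log (1 + (M.σ ^ 2)⁻¹ • gram H M.pt).det := h1
      _ ≤ 4 * ℓ * (2 * γ) := by gcongr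
      _ ≤ 4 * (2 * L) * (2 * γ) := by gcongr
      _ = γ * (16 * L) := by ring
      _ ≤ γ * (300 * L ^ 3) := by
        refine mul_le_mul_of_nonneg_left ?_ hgain
        -- `L > 1 / 2` gives `300 * L ^ 2 > 75 > 16`.
        nlinarith [mul_pos (by linarith : 0 < L) (by nlinarith : 0 < 300 * L ^ 2 - 16)]
      _ = _ := by ring

end GPRegression

end GP

/-! ### Probabilistic constraints. -/

section

variable {n m : ℕ} {sys : ControlSystem n m} {C : Set (Vec n)} {V W S h B : Vec n → ℝ}
  {η : ℝ} {α ζ : ℝ → ℝ} {est : Estimates n m}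

lemma inner_augment (γ : Vec (m + 1)) (u : Vec m) :
    ⟪γ, augment u⟫_ℝ = γ 0 + ⟪tail γ, u⟫_ℝ := by
  simp [PiLp.inner_apply, Fin.sum_univ_succ, augment, tail]

lemma norm_augment_le {u : Vec m} {b : ℝ} (hu : ‖u‖ ≤ b) : ‖augment u‖ ≤ √(1 + b ^ 2) := by
  refine Real.le_sqrt_of_sq_le ?_
  have h1 : ‖augment u‖ ^ 2 = 1 + ‖u‖ ^ 2 := by
    rw [EuclideanSpace.norm_sq_eq, EuclideanSpace.norm_sq_eq, Fin.sum_univ_succ]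
    simp [augment]
  rw [h1]
  have := pow_le_pow_left₀ (norm_nonneg u) hu 2
  linarith

lemma toEuclideanLin_augment (G : Matrix (Fin (m + 1)) (Fin (m + 1)) ℝ) (u : Vec m) :
    Matrix.toEuclideanLin G (augment u)
      = Matrix.toEuclideanLin (G.submatrix id Fin.succ) u + WithLp.toLp 2 fun i => G i 0 := by
  ext i
  simp [Matrix.toLpLin_apply, Matrix.mulVec, dotProduct, Fin.sum_univ_succ, augment, add_comm]

lemma norm_socc_eq (G : Matrix (Fin (m + 1)) (Fin (m + 1)) ℝ) {β : ℝ} (hβ : 0 ≤ β) (u : Vec m) :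
    ‖Matrix.toEuclideanLin (β • G.submatrix id Fin.succ) u + β • WithLp.toLp 2 fun i => G i 0‖
      = β * ‖Matrix.toEuclideanLin G (augment u)‖ := by
  rw [map_smul, LinearMap.smul_apply, ← smul_add, norm_smul, Real.norm_of_nonneg hβ,
    toEuclideanLin_augment]

/-- A bound on the maximum singular value bounds the scaled predicted standard deviation. -/
lemma mul_norm_toEuclideanLin_augment_lt {G : Matrix (Fin (m + 1)) (Fin (m + 1)) ℝ}
    {β b c : ℝ} (hβ : 0 ≤ β) (hG : sigmaMax G < c / (2 * β * √(1 + b ^ 2))) {u : Vec m}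
    (hu : ‖u‖ ≤ b) : 2 * (β * ‖Matrix.toEuclideanLin G (augment u)‖) < c := by
  have hσ : 0 ≤ sigmaMax G := LinearMap.singularValues_nonneg _ 0
  -- For `β = 0` the quotient is `0` by convention, and no singular value lies below it.
  have hβ' : 0 < β := by
    refine lt_of_le_of_ne hβ fun h => ?_
    rw [← h, mul_zero, zero_mul, div_zero] at hG
    linarith
  have hr : 0 < √(1 + b ^ 2) := Real.sqrt_pos.2 (by positivity)
  rw [lt_div_iff₀ (by positivity)] at hG
  have h1 : ‖Matrix.toEuclideanLin G (augment u)‖ ≤ sigmaMax G * √(1 + b ^ 2) :=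
    (norm_apply_le_singularValues_zero _ _).trans
      (mul_le_mul_of_nonneg_left (norm_augment_le hu) hσ)
  nlinarith [mul_le_mul_of_nonneg_left h1 hβ]

/-- The confidence radius `β s` is paid twice, in passing from `Δ_V` to its mean and as the margin
of the constraint; the factor `2` in the variance hypothesis absorbs both. -/
lemma gpSOCCV_holdsStrictly {β : ℝ} (hβ : 0 ≤ β) {γ : Vec n → Vec (m + 1)}
    {G : Vec n → Matrix (Fin (m + 1)) (Fin (m + 1)) ℝ} {x : Vec n} {u : Vec m}
    (hu : ‖u‖ ≤ B x) (hV : lieDeriv sys V x u + W x ≤ -S x)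
    (herr : |deltaV sys est V (x, u) - ⟪γ x, augment u⟫_ℝ|
      ≤ β * ‖Matrix.toEuclideanLin (G x) (augment u)‖)
    (hG : sigmaMax (G x) < S x / (2 * β * √(1 + B x ^ 2))) :
    (gpSOCCV est V W β γ G).HoldsStrictly x u := by
  have h1 := mul_norm_toEuclideanLin_augment_lt hβ hG hu
  rw [SOCC.HoldsStrictly]
  simp only [gpSOCCV]
  rw [norm_socc_eq (G x) hβ, inner_sub_left, inner_neg_left,
    ContinuousLinearMap.adjoint_inner_left]
  have h2 := (abs_le.1 herr).1
  rw [inner_augment] at h2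
  simp only [deltaV] at h2
  linarith

lemma gpSOCCh_holdsStrictly {β : ℝ} (hβ : 0 ≤ β) {γ : Vec n → Vec (m + 1)}
    {G : Vec n → Matrix (Fin (m + 1)) (Fin (m + 1)) ℝ} {x : Vec n} {u : Vec m}
    (hu : ‖u‖ ≤ B x) (hh : η + ζ (h x) ≤ lieDeriv sys h x u + α (h x))
    (herr : |deltaH sys est h α (x, u) - ⟪γ x, augment u⟫_ℝ|
      ≤ β * ‖Matrix.toEuclideanLin (G x) (augment u)‖)
    (hG : sigmaMax (G x) < (η + ζ (h x)) / (2 * β * √(1 + B x ^ 2))) :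
    (gpSOCCh est α β γ G).HoldsStrictly x u := by
  have h1 := mul_norm_toEuclideanLin_augment_lt hβ hG hu
  rw [SOCC.HoldsStrictly]
  simp only [gpSOCCh]
  rw [norm_socc_eq (G x) hβ, inner_add_left, ContinuousLinearMap.adjoint_inner_left]
  have h2 := (abs_le.1 herr).2
  rw [inner_augment] at h2
  simp only [deltaH] at h2
  linarith

end

end SafeStab

/-! ### The main theorem. -/

open SafeStab
theorem corollary1 {n m : ℕ}
    -- the true system, with locally Lipschitz `f`, `g` and `f(0) = 0`
    (sys : ControlSystem n m)
    (hf : LocallyLipschitz sys.f) (hg : LocallyLipschitz sys.g) (hf0 : sys.f 0 = 0)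
    -- robust control barrier function, and control Lyapunov function on a set containing `C`
    (C : Set (Vec n)) (h : Vec n → ℝ) (η : ℝ) (α : ℝ → ℝ) (hh : IsRobustCBF sys C h η α)
    (Γ : Set (Vec n)) (V W : Vec n → ℝ) (hV : IsCLF sys Γ V W) (hCΓ : C ⊆ Γ)
    -- slacks, compatible and continuous on `C`
    (S : Vec n → ℝ) (hS : IsPosDefFun S) (ζ : ℝ → ℝ) (hζ : IsClassKInf ζ) (B : Vec n → ℝ)
    (hcompat : SlackCompatible sys C V W S h η α ζ B)
    (hScont : ContinuousOn S C) (hαcont : ContinuousOn (fun x => α (h x)) C)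
    (hζcont : ContinuousOn (fun x => ζ (h x)) C)
    -- a neighborhood of `C`
    (C' : Set (Vec n)) (hC' : C' ∈ 𝓝ˢ C)
    -- the estimates
    (est : Estimates n m) :
    -- worst-case error bounds
    (∀ (e : ErrorBounds n) (Kα : NNReal), e.Valid sys h est C → LipschitzWith Kα α →
      SmallErrors est e V S h B η ζ Kα (C' \ {0}) →
      ∃ k : Vec n → Vec m, k 0 = 0 ∧ ContDiffOn ℝ (⊤ : ℕ∞) k (C' \ {0}) ∧
        IsSafeStabilized (sys.closedLoop k) C ∧
        ((worstCaseSOCCV est e V W).ContOn (C \ {0}) →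
          (worstCaseSOCCh est e α).ContOn (C \ {0}) →
          ∀ x ∈ C \ {0}, (worstCaseSOCCV est e V W).Holds x (k x) ∧
            (worstCaseSOCCh est e α).Holds x (k x))) ∧
    -- Gaussian process predictions
    (∀ (Ω : Type*) [MeasurableSpace Ω] (P : Measure Ω) [IsProbabilityMeasure P]
      (HV : Type*) [NormedAddCommGroup HV] [InnerProductSpace ℝ HV] [CompleteSpace HV]
      [RKHS ℝ HV (Vec n × Vec m) ℝ]
      (Hh : Type*) [NormedAddCommGroup Hh] [InnerProductSpace ℝ Hh] [CompleteSpace Hh]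
      [RKHS ℝ Hh (Vec n × Vec m) ℝ]
      (MV : GPRegression HV P (C ×ˢ univ) (deltaV sys est V))
      (Mh : GPRegression Hh P (C ×ˢ univ) (deltaH sys est h α))
      (γV : (Fin MV.N → ℝ) → Vec n → Vec (m + 1))
      (γh : (Fin Mh.N → ℝ) → Vec n → Vec (m + 1))
      (GV Gh : Vec n → Matrix (Fin (m + 1)) (Fin (m + 1)) ℝ)
      (δ β : ℝ), MV.IsAffineQuadratic C γV GV → Mh.IsAffineQuadratic C γh Gh →
      0 < δ → δ < 1 → MV.beta δ ≤ β → Mh.beta δ ≤ β →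
      SmallVariances GV Gh S h B η ζ β (C' \ {0}) →
      ∃ k : (Fin MV.N → ℝ) → (Fin Mh.N → ℝ) → Vec n → Vec m,
        (∀ yV yh, k yV yh 0 = 0 ∧ ContDiffOn ℝ (⊤ : ℕ∞) (k yV yh) (C' \ {0})) ∧
        ∃ E : Set Ω, MeasurableSet E ∧ ENNReal.ofReal (1 - 2 * δ) ≤ P E ∧
          ∀ ω ∈ E,
            IsSafeStabilized (sys.closedLoop (k (MV.obs ω) (Mh.obs ω))) C ∧
            ((gpSOCCV est V W β (γV (MV.obs ω)) GV).ContOn (C \ {0}) →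
              (gpSOCCh est α β (γh (Mh.obs ω)) Gh).ContOn (C \ {0}) →
              ∀ x ∈ C \ {0},
                (gpSOCCV est V W β (γV (MV.obs ω)) GV).Holds x (k (MV.obs ω) (Mh.obs ω) x) ∧
                (gpSOCCh est α β (γh (Mh.obs ω)) Gh).Holds x
                  (k (MV.obs ω) (Mh.obs ω) x))) := by
  have hsub : C ⊆ C' := subset_of_mem_nhdsSet hC'
  refine ⟨fun e Kα he hα hsmall => ?_, ?_⟩
  · obtain ⟨k, hk0, hksm, hks, hkq⟩ := exists_controller_of_holdsStrictly hf hg hh hV hCΓ hS hζ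
      hcompat hαcont (worstCaseSOCCV est e V W) (worstCaseSOCCh est e α)
      fun x hx u h1 h2 h3 => by
        obtain ⟨hsV, hsh⟩ := hsmall x ⟨hsub hx.1, hx.2⟩
        exact ⟨worstCaseSOCCV_holdsStrictly he hx.1 h3 h1 hsV,
          worstCaseSOCCh_holdsStrictly he hα hh.classKInf.strictMono.monotone hx.1 h3 h2 hsh⟩
    exact ⟨k, hk0, hksm.mono fun x hx => hx.2, hks, hkq⟩
  · intro Ω _ P _ HV _ _ _ _ Hh _ _ _ _ MV Mh γV γh GV Gh δ β hMV hMh hδ hδ1 hβV hβh hsmall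
    have hβ : 0 ≤ β := (Real.sqrt_nonneg _).trans hβV
    obtain ⟨EV, hEVm, hEVp, hEV⟩ := MV.exists_confidence_event hδ hδ1
    obtain ⟨Eh, hEhm, hEhp, hEh⟩ := Mh.exists_confidence_event hδ hδ1
    -- the requirements on the controller, for given data
    let Good : (Fin MV.N → ℝ) → (Fin Mh.N → ℝ) → (Vec n → Vec m) → Prop := fun yV yh k =>
      k 0 = 0 ∧ ContDiffOn ℝ (⊤ : ℕ∞) k {0}ᶜ ∧ IsSafeStabilized (sys.closedLoop k) C ∧
      ((gpSOCCV est V W β (γV yV) GV).ContOn (C \ {0}) →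
        (gpSOCCh est α β (γh yh) Gh).ContOn (C \ {0}) →
        ∀ x ∈ C \ {0}, (gpSOCCV est V W β (γV yV) GV).Holds x (k x) ∧
          (gpSOCCh est α β (γh yh) Gh).Holds x (k x))
    have hgood : ∀ ω ∈ EV ∩ Eh, ∃ k, Good (MV.obs ω) (Mh.obs ω) k := by
      rintro ω ⟨hωV, hωh⟩
      refine exists_controller_of_holdsStrictly hf hg hh hV hCΓ hS hζ hcompat hαcont _ _
        fun x hx u h1 h2 h3 => ?_
      obtain ⟨hsV, hsh⟩ := hsmall x ⟨hsub hx.1, hx.2⟩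
      have heV := hEV ω hωV (x, u) ⟨hx.1, mem_univ u⟩
      have heh := hEh ω hωh (x, u) ⟨hx.1, mem_univ u⟩
      rw [hMV.mean_eq _ x hx.1 u, hMV.std_eq x hx.1 u] at heV
      rw [hMh.mean_eq _ x hx.1 u, hMh.std_eq x hx.1 u] at heh
      exact ⟨gpSOCCV_holdsStrictly hβ h3 h1 (heV.trans (by gcongr)) hsV,
        gpSOCCh_holdsStrictly hβ h3 h2 (heh.trans (by gcongr)) hsh⟩
    classical
    -- `Good` involves `ω` only through the measurements, so the choice is a function of the data.
    -- Data for which no good controller exists receive the zero controller, so that smoothness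
    -- holds for all data.
    let k : (Fin MV.N → ℝ) → (Fin Mh.N → ℝ) → Vec n → Vec m := fun yV yh =>
      if hex : ∃ k, Good yV yh k then hex.choose else fun _ => 0
    have hk : ∀ yV yh, (∃ k, Good yV yh k) → Good yV yh (k yV yh) := fun yV yh hex => by
      simp only [k, dif_pos hex]
      exact hex.choose_spec
    refine ⟨k, fun yV yh => ?_, EV ∩ Eh, hEVm.inter hEhm, ?_, fun ω hω => ?_⟩
    · by_cases hex : ∃ k, Good yV yh k
      · exact ⟨(hk yV yh hex).1, (hk yV yh hex).2.1.mono fun x hx => hx.2⟩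
      · simp only [k, dif_neg hex]
        exact ⟨trivial, contDiffOn_const⟩
    · have h1 : P (EV ∩ Eh)ᶜ ≤ ENNReal.ofReal (2 * δ) := by
        rw [compl_inter]
        refine (measure_union_le _ _).trans ((add_le_add hEVp hEhp).trans_eq ?_)
        rw [← ENNReal.ofReal_add hδ.le hδ.le, two_mul]
      have h2 : P (EV ∩ Eh) = 1 - P (EV ∩ Eh)ᶜ := by
        rw [← prob_compl_eq_one_sub (hEVm.inter hEhm).compl, compl_compl]
      rw [h2, ENNReal.ofReal_sub _ (by positivity), ENNReal.ofReal_one]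
      exact tsub_le_tsub_left h1 1
    · exact (hk _ _ (hgood ω hω)).2.2
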